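/- Let $m\ge 1$, let $(a,b)\subset\mathbb R$ be a non-empty, bounded or unbounded, open interval, and let $\varphi:(0,\infty)\to(0,\infty)$ satisfy: (i) $\varphi\in C^1((0,\infty))$; (ii) $(s\varphi(s))'>0$ for all $s>0$; (iii) the range of $s\mapsto s\varphi(s)$ is $(0,\infty)$; (iv) there are $C_1,C_2>0$, $r>-1$ and $s_0>0$ such that $C_1s^r\le (s\varphi(s))'\le C_2s^r$ for $s\in(0,s_0)$, and, if $r=0$, moreover $\lim_{s\to0^+}\varphi(s)$ exists, is finite and positive, and $\lim_{s\to0^+}s\varphi'(s)=0$; (v) there is $s_1>s_0$ such that either $\varphi'\ge0$ on $[s_1,\infty)$ or $\varphi'\le 0$ on $[s_1,\infty)$; (vi) $s\mapsto|s\varphi'(s)/\varphi(s)|$ is non-decreasing on $(0,\infty)$. Define $\Lambda$ on $(0,\infty)$ by $$\Lambda\bigl(s\sqrt{\varphi(s)}\bigr)=-\frac{s\varphi'(s)}{s\varphi'(s)+2\varphi(s)}\qquad(s>0),$$ put $\Lambda_\infty^2=\sup_{t>0}\Lambda^2(t)$, and assume $\Lambda_\infty^2<1$. For an $m\times m$ complex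 matrix function $\mathscr B$ on $(a,b)$ with locally integrable entries, the operator $Bu=(\mathscr B u')'$ is called $L^\Phi$-dissipative (where $\Phi(s)=\int_0^s\sigma\varphi(\sigma)\,d\sigma$) if $$\operatorname{Re}\int_a^b\langle\mathscr B u',(\varphi(|u|)u)'\rangle\,dx\ge0$$ for every $u\in[C_0^1((a,b))]^m$ (complex-valued $C^1$ functions with compact support in $(a,b)$) such that $\varphi(|u|)u\in[C_0^1((a,b))]^m$, where $\varphi(|u|)u$ is understood to be $0$ wherever $u=0$. Let $\mathscr A$ be an $m\times m$ real symmetric matrix function on $(a,b)$ with locally integrable entries and $\mathscr A>0$ almost everywhere, i.e. for almost every $x\in(a,b)$, $\langle\mathscr A(x)\xi,\xi\rangle>0$ for all $\xi\in\mathbb R^m\setminus\{0\}$. Let $\mu_1(x)$ and $\mu_m(x)$ be the smallest and the largest eigenvalue of $\mathscr A(x)$, and let $Au=(\mathscr Au')'$, so that $A-\kappa I\,d^2/dx^2$ is the operator $u\mapsto((\mathscr A-\kappa I)u')'$. If there exists $\kappa>0$ such that $A-\kappa I\,(d^2/dx^2)$ is $L^\Phi$-dissipative, then $$\operatorname*{ess\,inf}_{x\in(a,b)}\Bigl[\mu_1(x)\mu_m(x)-\frac{\Lambda_\infty^2}{4}\bigl(\mu_1(x)+\mu_m(x)\bigr)^2\Bigr]>0.\qquad(*)$$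 If, in addition, there exists a constant $C$ such that $\langle\mathscr A(x)\xi,\xi\rangle\le C|\xi|^2$ for almost every $x\in(a,b)$ and all $\xi\in\mathbb R^m$, then the converse is also true: $(*)$ implies that $A-\kappa I\,(d^2/dx^2)$ is $L^\Phi$-dissipative for some $\kappa>0$. In the particular case $m=2$, condition $(*)$ is equivalent to $$\operatorname*{ess\,inf}_{x\in(a,b)}\Bigl[\det\mathscr A(x)-\frac{\Lambda_\infty^2}{4}(\operatorname{tr}\mathscr A(x))^2\Bigr]>0.$$ -/

import Mathlib

open MeasureTheory Set Filter Topology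

noncomputable section

namespace FunctionalDissipativity

/-- The standing assumptions on the weight `φ`, of which only the values on `(0, ∞)` matter. -/
structure Admissible (φ : ℝ → ℝ) : Prop where
  pos : ∀ s, 0 < s → 0 < φ s
  contDiffOn : ContDiffOn ℝ 1 φ (Ioi 0)
  deriv_mul_pos : ∀ s, 0 < s → 0 < deriv (fun σ => σ * φ σ) s
  range_eq : (fun s => s * φ s) '' Ioi 0 = Ioi 0
  /-- Power behaviour of order `r` on `(0, s₀)`, with the additional requirements for `r = 0`,
  and a constant sign of `φ'` on `[s₁, ∞)` for some `s₁ > s₀`. -/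
  growth : ∃ C₁ C₂ r s₀ : ℝ, 0 < C₁ ∧ 0 < C₂ ∧ -1 < r ∧ 0 < s₀ ∧
    (∀ s ∈ Ioo 0 s₀, C₁ * s ^ r ≤ deriv (fun σ => σ * φ σ) s ∧
      deriv (fun σ => σ * φ σ) s ≤ C₂ * s ^ r) ∧
    (r = 0 → (∃ l : ℝ, 0 < l ∧ Tendsto φ (𝓝[>] 0) (𝓝 l)) ∧
      Tendsto (fun s => s * deriv φ s) (𝓝[>] 0) (𝓝 0)) ∧
    ∃ s₁, s₀ < s₁ ∧ ((∀ s, s₁ ≤ s → 0 ≤ deriv φ s) ∨ (∀ s, s₁ ≤ s → deriv φ s ≤ 0))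
  monotone_ratio : MonotoneOn (fun s => |s * deriv φ s / φ s|) (Ioi 0)

/-- The function `Λ` on `(0, ∞)`, given by
`Λ (s √φ(s)) = - s φ'(s) / (s φ'(s) + 2 φ(s))`: the number `s > 0` is recovered from
`t = s √φ(s)` through the inverse of the (bijective) map `s ↦ s √φ(s)` of `(0, ∞)`. -/
def Lam (φ : ℝ → ℝ) (t : ℝ) : ℝ :=
  (fun s => -(s * deriv φ s / (s * deriv φ s + 2 * φ s)))
    (Function.invFunOn (fun σ => σ * √(φ σ)) (Ioi 0) t)

/-- `Λ_∞² = sup_{t > 0} Λ(t)²`. -/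
def lamInftySq (φ : ℝ → ℝ) : ℝ := ⨆ t : Ioi (0 : ℝ), Lam φ t ^ 2

/-- The bounded or unbounded open interval `(a, b)` of the real line. -/
def interval (a b : EReal) : Set ℝ := {x : ℝ | a < (x : EReal) ∧ (x : EReal) < b}

/-- The space `[C_0^1(I)]^m` of `C¹` vector functions with compact support in `I`
(extended by zero to the whole line). -/
def IsTest {m : ℕ} (I : Set ℝ) (u : ℝ → EuclideanSpace ℂ (Fin m)) : Prop :=
  ContDiff ℝ 1 u ∧ HasCompactSupport u ∧ tsupport u ⊆ I

/-- `L^Φ`-dissipativity on `I` of the operator `u ↦ (𝓐 u')'`: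
`Re ∫ ⟨𝓐 u', (φ(|u|) u)'⟩ dx ≥ 0` for all `u ∈ [C_0^1(I)]^m` with `φ(|u|) u ∈ [C_0^1(I)]^m`.
Mathlib's inner product is conjugate linear in the first slot. -/
def LPhiDissipative {m : ℕ} (φ : ℝ → ℝ) (I : Set ℝ) (𝓐 : ℝ → Matrix (Fin m) (Fin m) ℂ) : Prop :=
  ∀ u : ℝ → EuclideanSpace ℂ (Fin m), IsTest I u → IsTest I (fun x => φ ‖u x‖ • u x) →
    0 ≤ (∫ x in I, inner ℂ (deriv (fun y => φ ‖u y‖ • u y) x)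
      (Matrix.toEuclideanLin (𝓐 x) (deriv u x))).re

/-- The coefficient matrix of `A - κ I d²/dx²`, where `A u = (𝓐 u')'` and `𝓐` is real. -/
def shifted {m : ℕ} (𝓐 : ℝ → Matrix (Fin m) (Fin m) ℝ) (κ : ℝ) (x : ℝ) :
    Matrix (Fin m) (Fin m) ℂ :=
  (𝓐 x - κ • (1 : Matrix (Fin m) (Fin m) ℝ)).map Complex.ofReal

/-- The set of real eigenvalues of a real matrix. -/
def eigenvalueSet {m : ℕ} (M : Matrix (Fin m) (Fin m) ℝ) : Set ℝ :=
  {μ | Module.End.HasEigenvalue (Matrix.toLin' M) μ}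

/-- The smallest eigenvalue `μ₁` (of a real symmetric matrix of size at least one). -/
def eigMin {m : ℕ} (M : Matrix (Fin m) (Fin m) ℝ) : ℝ := sInf (eigenvalueSet M)

/-- The largest eigenvalue `μ_m` (of a real symmetric matrix of size at least one). -/
def eigMax {m : ℕ} (M : Matrix (Fin m) (Fin m) ℝ) : ℝ := sSup (eigenvalueSet M)

/-- The essential infimum over `I` of a real function, as an extended real number. -/
def essInfOn (I : Set ℝ) (f : ℝ → ℝ) : EReal :=
  essInf (fun x => (f x : EReal)) (volume.restrict I)

/-- `ess inf_{x ∈ I} [μ₁ μ_m - (Λ_∞² / 4) (μ₁ + μ_m)²] > 0`. -/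
def EigenCondition {m : ℕ} (φ : ℝ → ℝ) (I : Set ℝ) (𝓐 : ℝ → Matrix (Fin m) (Fin m) ℝ) : Prop :=
  0 < essInfOn I (fun x => eigMin (𝓐 x) * eigMax (𝓐 x)
    - lamInftySq φ / 4 * (eigMin (𝓐 x) + eigMax (𝓐 x)) ^ 2)

end FunctionalDissipativity

end

/-!
Off the zeros of `u` the derivative of `φ(|u|) u` is linear in `u'`, with coefficients depending
only on the value of `u`. Hence `L^Φ`-dissipativity follows from the almost everywhere
nonnegativity of the integrand for all values `y ≠ 0` and slopes `ζ`. Conversely, test functions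
equal to `y + w ζ` on an interval, with a small and rapidly oscillating `w`, make the slope term
dominate all others and recover that pointwise condition.

For a symmetric matrix, splitting `ζ` along and across `y` turns the pointwise condition into
`⟨T x, y⟩² ≤ (1 - Λ_∞²) ⟨T x, x⟩ ⟨T y, y⟩` for orthogonal `x`, `y`. By Wielandt's inequality, with
its equality case, this holds exactly when `Λ_∞² (α + β)² ≤ 4 α β` for the extreme eigenvalues
`0 ≤ α ≤ β`. With `α = μ₁ - κ` and `β = μ_m - κ` this is
`(1 - Λ_∞²) κ (μ₁ + μ_m - κ) ≤ μ₁ μ_m - (Λ_∞² / 4) (μ₁ + μ_m)²`, whose left side is at least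
`(1 - Λ_∞²) κ²` and is small together with `κ` when the eigenvalues are bounded.
-/

open scoped InnerProductSpace

namespace FunctionalDissipativity

/-- Weights for which `s ↦ s φ(s)` is a `C¹` bijection of `(0, ∞)` with positive derivative. -/
structure IsWeight (φ : ℝ → ℝ) : Prop where
  contDiffOn : ContDiffOn ℝ 1 φ (Ioi 0)
  deriv_mul_pos : ∀ s, 0 < s → 0 < deriv (fun σ => σ * φ σ) s
  range_eq : (fun s => s * φ s) '' Ioi 0 = Ioi 0

theorem Admissible.isWeight {φ : ℝ → ℝ} (hφ : Admissible φ) : IsWeight φ :=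
  ⟨hφ.contDiffOn, hφ.deriv_mul_pos, hφ.range_eq⟩

/-- The logarithmic slope `q = s φ'(s) / φ(s)`, in terms of which `Λ² = (q / (q + 2))²`. -/
noncomputable def ratio (φ : ℝ → ℝ) (s : ℝ) : ℝ := s * deriv φ s / φ s

theorem lamInftySq_nonneg (φ : ℝ → ℝ) : 0 ≤ lamInftySq φ :=
  Real.iSup_nonneg fun _ => sq_nonneg _

theorem mul_sqrt_eq_sqrt {s : ℝ} (hs : 0 ≤ s) (c : ℝ) : s * √c = √(s * (s * c)) := by
  rw [← mul_assoc, Real.sqrt_mul (mul_self_nonneg s), Real.sqrt_mul_self hs]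

namespace IsWeight

variable {φ : ℝ → ℝ} (hφ : IsWeight φ)
include hφ

theorem mul_pos {s : ℝ} (hs : 0 < s) : 0 < s * φ s := by
  have h : s * φ s ∈ (fun s => s * φ s) '' Ioi 0 := mem_image_of_mem _ hs
  rwa [hφ.range_eq] at h

theorem pos {s : ℝ} (hs : 0 < s) : 0 < φ s :=
  (mul_pos_iff_of_pos_left hs).1 (hφ.mul_pos hs)

theorem contDiffAt {s : ℝ} (hs : 0 < s) : ContDiffAt ℝ 1 φ s :=
  hφ.contDiffOn.contDiffAt (Ioi_mem_nhds hs)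

theorem differentiableAt {s : ℝ} (hs : 0 < s) : DifferentiableAt ℝ φ s :=
  (hφ.contDiffAt hs).differentiableAt one_ne_zero

theorem continuousAt_deriv {s : ℝ} (hs : 0 < s) : ContinuousAt (deriv φ) s :=
  (hφ.contDiffOn.continuousOn_deriv_of_isOpen isOpen_Ioi le_rfl).continuousAt (Ioi_mem_nhds hs)

theorem hasDerivAt_mul {s : ℝ} (hs : 0 < s) :
    HasDerivAt (fun σ => σ * φ σ) (φ s + s * deriv φ s) s := by
  simpa using (hasDerivAt_id' s).fun_mul (hφ.differentiableAt hs).hasDerivAt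

theorem add_mul_deriv_pos {s : ℝ} (hs : 0 < s) : 0 < φ s + s * deriv φ s :=
  (hφ.hasDerivAt_mul hs).deriv ▸ hφ.deriv_mul_pos s hs

theorem neg_one_lt_ratio {s : ℝ} (hs : 0 < s) : -1 < ratio φ s := by
  rw [ratio, lt_div_iff₀ (hφ.pos hs)]
  linarith [hφ.add_mul_deriv_pos hs]

theorem continuousOn_mul : ContinuousOn (fun s => s * φ s) (Ioi 0) := fun _ hs =>
  (hφ.hasDerivAt_mul hs).continuousAt.continuousWithinAt

theorem strictMonoOn_mul : StrictMonoOn (fun s => s * φ s) (Ioi 0) :=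
  strictMonoOn_of_deriv_pos (convex_Ioi 0) hφ.continuousOn_mul (by simpa using hφ.deriv_mul_pos)

theorem exists_mul_eq {t : ℝ} (ht : 0 < t) : ∃ s, 0 < s ∧ s * φ s = t := by
  have h : t ∈ (fun s => s * φ s) '' Ioi 0 := by rwa [hφ.range_eq]
  exact h

theorem tendsto_mul_nhdsGT_zero : Tendsto (fun s => s * φ s) (𝓝[>] 0) (𝓝 0) := by
  refine tendsto_order.2 ⟨fun c hc => ?_, fun c hc => ?_⟩
  · filter_upwards [self_mem_nhdsWithin] with s hs using hc.trans (hφ.mul_pos hs)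
  · obtain ⟨s, hs, rfl⟩ := hφ.exists_mul_eq hc
    filter_upwards [Ioo_mem_nhdsGT hs] with t ht using hφ.strictMonoOn_mul ht.1 hs ht.2

theorem tendsto_mul_atTop : Tendsto (fun s => s * φ s) atTop atTop := by
  refine tendsto_atTop.2 fun c => ?_
  obtain ⟨s, hs, hsc⟩ := hφ.exists_mul_eq (lt_max_of_lt_left one_pos : 0 < max 1 c)
  filter_upwards [eventually_ge_atTop s] with t hst
  exact (le_max_right 1 c).trans (hsc ▸ hφ.strictMonoOn_mul.monotoneOn hs (hs.trans_le hst) hst)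

theorem strictMonoOn_mul_sqrt : StrictMonoOn (fun s => s * √(φ s)) (Ioi 0) := by
  intro s (hs : 0 < s) t (ht : 0 < t) hst
  simp only [mul_sqrt_eq_sqrt hs.le, mul_sqrt_eq_sqrt ht.le]
  exact Real.sqrt_lt_sqrt (_root_.mul_pos hs (hφ.mul_pos hs)).le
    (mul_lt_mul'' hst (hφ.strictMonoOn_mul hs ht hst) hs.le (hφ.mul_pos hs).le)

theorem surjOn_mul_sqrt : SurjOn (fun s => s * √(φ s)) (Ioi 0) (Ioi 0) := by
  intro t (ht : 0 < t)
  have hzero : Tendsto (fun s => s * (s * φ s)) (𝓝[>] 0) (𝓝 0) := by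
    simpa using (tendsto_id.mono_right nhdsWithin_le_nhds).mul hφ.tendsto_mul_nhdsGT_zero
  have htop : Tendsto (fun s => s * (s * φ s)) atTop atTop :=
    tendsto_id.atTop_mul_atTop₀ hφ.tendsto_mul_atTop
  obtain ⟨s, hs, hst⟩ := isPreconnected_Ioi.intermediate_value_Ioi
    (le_principal_iff.2 self_mem_nhdsWithin) (le_principal_iff.2 (Ioi_mem_atTop 0))
    (continuousOn_id.mul hφ.continuousOn_mul) hzero htop (pow_pos ht 2 : t ^ 2 ∈ Ioi 0)
  refine ⟨s, hs, ?_⟩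
  simp only [mul_sqrt_eq_sqrt (le_of_lt hs)]
  rw [show s * (s * φ s) = t ^ 2 from hst, Real.sqrt_sq ht.le]

theorem lam_mul_sqrt {s : ℝ} (hs : 0 < s) :
    Lam φ (s * √(φ s)) = -(ratio φ s / (ratio φ s + 2)) := by
  have hinv : Function.invFunOn (fun σ => σ * √(φ σ)) (Ioi 0) (s * √(φ s)) = s :=
    hφ.strictMonoOn_mul_sqrt.injOn.leftInvOn_invFunOn (show s ∈ Ioi 0 from hs)
  have hq : s * deriv φ s = ratio φ s * φ s := (div_mul_cancel₀ _ (hφ.pos hs).ne').symm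
  rw [Lam, hinv]
  simp only [hq, ← add_mul, mul_div_mul_right _ _ (hφ.pos hs).ne']

theorem lamInftySq_eq_iSup :
    lamInftySq φ = ⨆ s : Ioi (0 : ℝ), (ratio φ s / (ratio φ s + 2)) ^ 2 := by
  let f : Ioi (0 : ℝ) → Ioi (0 : ℝ) := fun s =>
    ⟨s * √(φ s), _root_.mul_pos s.2 (Real.sqrt_pos.2 (hφ.pos s.2))⟩
  have hf : Function.Surjective f := fun t => by
    obtain ⟨s, hs, hst⟩ := hφ.surjOn_mul_sqrt t.2
    exact ⟨⟨s, hs⟩, Subtype.ext hst⟩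
  rw [lamInftySq, ← hf.iSup_comp]
  exact iSup_congr fun s => by rw [hφ.lam_mul_sqrt s.2, neg_sq]

theorem ratio_div_sq_le_one {s : ℝ} (hs : 0 < s) : (ratio φ s / (ratio φ s + 2)) ^ 2 ≤ 1 := by
  have hq := hφ.neg_one_lt_ratio hs
  rw [div_pow]
  exact div_le_one_of_le₀ (by nlinarith) (sq_nonneg _)

theorem lamInftySq_mul_le_iff {c d : ℝ} (hd : 0 ≤ d) :
    lamInftySq φ * d ≤ c ↔ ∀ s, 0 < s → (ratio φ s / (ratio φ s + 2)) ^ 2 * d ≤ c := by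
  have hbdd : BddAbove (range fun s : Ioi (0 : ℝ) => (ratio φ s / (ratio φ s + 2)) ^ 2 * d) :=
    ⟨d, forall_mem_range.2 fun s =>
      mul_le_of_le_one_left hd (hφ.ratio_div_sq_le_one s.2)⟩
  rw [hφ.lamInftySq_eq_iSup, Real.iSup_mul_of_nonneg hd, ciSup_le_iff hbdd, Subtype.forall]
  rfl

theorem lamInftySq_le_one : lamInftySq φ ≤ 1 :=
  (mul_one _).symm.trans_le ((hφ.lamInftySq_mul_le_iff zero_le_one).2 fun _ hs =>
    (mul_one _).trans_le (hφ.ratio_div_sq_le_one hs))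

end IsWeight

theorem contDiff_one_comp_sq {σ σ' : ℝ → ℝ} {C : ℝ} (hσ : Continuous σ)
    (hderiv : ∀ t, 0 < t → HasDerivAt σ (σ' t) t) (hcont : ContinuousOn σ' (Ioi 0))
    (hbound : ∀ t, 0 < t → |σ' t| ≤ C) : ContDiff ℝ 1 fun t => σ (t ^ 2) := by
  have hsq {t : ℝ} (ht : t ≠ 0) : 0 < t ^ 2 := by positivity
  let D : ℝ → ℝ := fun t => σ' (t ^ 2) * (2 * t)
  have hD (t : ℝ) : |D t| ≤ C * |2 * t| := by
    rcases eq_or_ne t 0 with rfl | ht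
    · simp [D]
    · rw [abs_mul]
      gcongr
      exact hbound _ (hsq ht)
  have hDcont : Continuous D := continuous_iff_continuousAt.2 fun t => by
    rcases eq_or_ne t 0 with rfl | ht
    · have hlim : Tendsto (fun t : ℝ => C * |2 * t|) (𝓝 0) (𝓝 0) :=
        Continuous.tendsto' (by fun_prop) _ _ (by simp)
      simpa [ContinuousAt, D] using squeeze_zero_norm hD hlim
    · exact ((hcont.continuousAt (Ioi_mem_nhds (hsq ht))).comp_of_eq
        (continuousAt_id.pow 2) rfl).mul (by fun_prop)
  have hderiv_sq (t : ℝ) : HasDerivAt (fun t => σ (t ^ 2)) (D t) t :=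
    hasDerivAt_of_hasDerivAt_of_ne' (x := 0)
      (fun t ht => (hderiv _ (hsq ht)).comp (h := fun t => t ^ 2) t
        (by simpa using hasDerivAt_pow 2 t))
      (hσ.comp (continuous_pow 2)).continuousAt hDcont.continuousAt t
  refine contDiff_one_iff_deriv.2 ⟨fun t => (hderiv_sq t).differentiableAt, ?_⟩
  rwa [funext fun t => (hderiv_sq t).deriv]

/-- The extension of `s ↦ s + s φ(s)` from `(0, ∞)` to the line by the identity. -/
noncomputable def addMul (φ : ℝ → ℝ) (s : ℝ) : ℝ := s + (Ioi 0).indicator (fun σ => σ * φ σ) s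

theorem addMul_of_nonneg (φ : ℝ → ℝ) {s : ℝ} (hs : 0 ≤ s) : addMul φ s = s + s * φ s := by
  rcases hs.eq_or_lt with rfl | hs
  · simp [addMul]
  · rw [addMul, indicator_of_mem (mem_Ioi.2 hs)]

theorem addMul_of_nonpos (φ : ℝ → ℝ) {s : ℝ} (hs : s ≤ 0) : addMul φ s = s := by
  rw [addMul, indicator_of_notMem (notMem_Ioi.2 hs), add_zero]

namespace IsWeight

variable {φ : ℝ → ℝ} (hφ : IsWeight φ)
include hφ

theorem hasDerivAt_addMul {s : ℝ} (hs : 0 < s) :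
    HasDerivAt (addMul φ) (1 + (φ s + s * deriv φ s)) s :=
  ((hasDerivAt_id s).add (hφ.hasDerivAt_mul hs)).congr_of_eventuallyEq <| by
    filter_upwards [Ioi_mem_nhds hs] with t ht using addMul_of_nonneg φ (le_of_lt ht)

theorem strictMono_addMul : StrictMono (addMul φ) := by
  refine strictMono_id.add_monotone fun s t hst => ?_
  by_cases hs : s ∈ Ioi 0
  · have ht : t ∈ Ioi 0 := hst.trans_lt' hs
    simpa only [indicator_of_mem hs, indicator_of_mem ht]
      using hφ.strictMonoOn_mul.monotoneOn hs ht hst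
  · rw [indicator_of_notMem hs]
    exact indicator_nonneg (fun σ hσ => (hφ.mul_pos hσ).le) t

theorem surjective_addMul : Function.Surjective (addMul φ) := by
  intro t
  rcases le_or_gt t 0 with ht | ht
  · exact ⟨t, addMul_of_nonpos φ ht⟩
  have hzero : Tendsto (fun s => s + s * φ s) (𝓝[>] 0) (𝓝 0) := by
    simpa using (tendsto_id.mono_right nhdsWithin_le_nhds).add hφ.tendsto_mul_nhdsGT_zero
  obtain ⟨s, hs, hst⟩ := isPreconnected_Ioi.intermediate_value_Ioi
    (le_principal_iff.2 self_mem_nhdsWithin) (le_principal_iff.2 (Ioi_mem_atTop 0))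
    (continuousOn_id.add hφ.continuousOn_mul) hzero
    (tendsto_id.atTop_add_atTop hφ.tendsto_mul_atTop) (mem_Ioi.2 ht)
  exact ⟨s, (addMul_of_nonneg φ (le_of_lt hs)).trans hst⟩

theorem exists_contDiff_add_mul_eq_sq : ∃ F : ℝ → ℝ, ContDiff ℝ 1 F ∧ (∀ t, 0 ≤ F t) ∧
    (∀ t, F t + F t * φ (F t) = t ^ 2) ∧ ∀ s, 0 ≤ s → F √(s + s * φ s) = s := by
  let e := hφ.strictMono_addMul.orderIsoOfSurjective _ hφ.surjective_addMul
  have he (t : ℝ) : addMul φ (e.symm t) = t := e.apply_symm_apply t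
  have he' (s : ℝ) : e.symm (addMul φ s) = s := e.symm_apply_apply s
  have hzero : e.symm 0 = 0 := e.symm_apply_eq.2 (addMul_of_nonpos φ le_rfl).symm
  have hnonneg {t : ℝ} (ht : 0 ≤ t) : 0 ≤ e.symm t := hzero ▸ e.symm.monotone ht
  have hpos {t : ℝ} (ht : 0 < t) : 0 < e.symm t := hzero ▸ e.symm.strictMono ht
  have hslope {t : ℝ} (ht : 0 < t) :
      1 < 1 + (φ (e.symm t) + e.symm t * deriv φ (e.symm t)) :=
    lt_add_of_pos_right 1 (hφ.add_mul_deriv_pos (hpos ht))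
  have hderiv (t : ℝ) (ht : 0 < t) : HasDerivAt e.symm
      (1 + (φ (e.symm t) + e.symm t * deriv φ (e.symm t)))⁻¹ t :=
    (hφ.hasDerivAt_addMul (hpos ht)).of_local_left_inverse e.symm.continuous.continuousAt
      (one_pos.trans (hslope ht)).ne' (Eventually.of_forall he)
  refine ⟨fun t => e.symm (t ^ 2),
    contDiff_one_comp_sq (C := 1) e.symm.continuous hderiv (fun t ht => ?_) (fun t ht => ?_),
    fun t => hnonneg (sq_nonneg t), fun t => ?_, fun s hs => ?_⟩
  · have hcont : ContinuousAt e.symm t := e.symm.continuous.continuousAt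
    have hφcont := (hφ.contDiffAt (hpos ht)).continuousAt.comp hcont
    have hφ'cont := (hφ.continuousAt_deriv (hpos ht)).comp hcont
    exact ((continuousAt_const.add (hφcont.add (hcont.mul hφ'cont))).inv₀
      (one_pos.trans (hslope ht)).ne').continuousWithinAt
  · rw [abs_of_pos (inv_pos.2 (one_pos.trans (hslope ht)))]
    exact inv_le_one_of_one_le₀ (hslope ht).le
  · rw [← addMul_of_nonneg φ (hnonneg (sq_nonneg t)), he]
  · have hsum : 0 ≤ s + s * φ s := by
      rcases hs.eq_or_lt with rfl | hs
      · simp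
      · exact (add_pos hs (hφ.mul_pos hs)).le
    change e.symm (√(s + s * φ s) ^ 2) = s
    rw [Real.sq_sqrt hsum, ← addMul_of_nonneg φ hs, he']

end IsWeight

section PointwiseDissipative

variable {E : Type*} [NormedAddCommGroup E] [InnerProductSpace ℝ E]

/-- The derivative at `y ≠ 0` in the direction `ζ` of the vector field `y ↦ φ(|y|) y`. -/
noncomputable def weightDeriv (φ : ℝ → ℝ) (y ζ : E) : E :=
  φ ‖y‖ • ζ + (deriv φ ‖y‖ * (⟪y, ζ⟫_ℝ / ‖y‖)) • y

/-- Dissipativity of a constant coefficient operator `T`, tested on all pairs of a value `y` and a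
slope `ζ`. -/
def PointwiseDissipative (φ : ℝ → ℝ) (T : E →ₗ[ℝ] E) : Prop :=
  ∀ y ζ : E, y ≠ 0 → 0 ≤ ⟪weightDeriv φ y ζ, T ζ⟫_ℝ

theorem forall_quadratic_nonneg_iff {a b c : ℝ} :
    (∀ s t : ℝ, 0 ≤ a * s ^ 2 + b * (s * t) + c * t ^ 2) ↔
      0 ≤ a ∧ 0 ≤ c ∧ b ^ 2 ≤ 4 * (a * c) := by
  constructor
  · intro h
    have hdiscrim : discrim a b c ≤ 0 := discrim_le_zero fun s => by linarith [h s 1]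
    exact ⟨by linarith [h 1 0], by linarith [h 0 1], by rw [discrim] at hdiscrim; linarith⟩
  · rintro ⟨ha, hc, hb⟩ s t
    rcases ha.eq_or_lt with rfl | ha
    · have : b = 0 := pow_eq_zero_iff two_ne_zero |>.1 (le_antisymm (by linarith) (sq_nonneg b))
      subst this
      linarith [mul_nonneg hc (sq_nonneg t)]
    · refine nonneg_of_mul_nonneg_right (a := 4 * a) ?_ (by positivity)
      nlinarith [sq_nonneg (2 * a * s + b * t), mul_nonneg (sub_nonneg.2 hb) (sq_nonneg t)]

theorem weightDeriv_smul_add {φ : ℝ → ℝ} {y e : E} (hy : φ ‖y‖ ≠ 0) (hye : ⟪y, e⟫_ℝ = 0) (p : ℝ) :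
    weightDeriv φ y (p • y + e) = φ ‖y‖ • (((1 + ratio φ ‖y‖) * p) • y + e) := by
  have hinner : ⟪y, p • y + e⟫_ℝ / ‖y‖ = p * ‖y‖ := by
    rw [inner_add_right, inner_smul_right, hye, add_zero, real_inner_self_eq_norm_mul_norm,
      mul_div_assoc, mul_self_div_self]
  rw [weightDeriv, hinner, ratio]
  match_scalars <;> field_simp

theorem IsWeight.ratio_div_sq_mul_le_iff {φ : ℝ → ℝ} (hφ : IsWeight φ) {s : ℝ} (hs : 0 < s)
    (a b d : ℝ) : (ratio φ s / (ratio φ s + 2)) ^ 2 * (a * d) ≤ a * d - b ^ 2 ↔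
      ((2 + ratio φ s) * b) ^ 2 ≤ 4 * ((1 + ratio φ s) * a * d) := by
  have hq : 0 < (2 + ratio φ s) ^ 2 := by
    have : 0 < 2 + ratio φ s := by linarith [hφ.neg_one_lt_ratio hs]
    positivity
  rw [div_pow, add_comm _ (2 : ℝ), div_mul_eq_mul_div, div_le_iff₀ hq]
  constructor <;> intro h <;> nlinarith

theorem inner_weightDeriv_smul_add {φ : ℝ → ℝ} {T : E →ₗ[ℝ] E} (hT : T.IsSymmetric) {y e : E}
    (hy : φ ‖y‖ ≠ 0) (hye : ⟪y, e⟫_ℝ = 0) (p t : ℝ) :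
    ⟪weightDeriv φ y (p • y + t • e), T (p • y + t • e)⟫_ℝ = φ ‖y‖ *
      ((1 + ratio φ ‖y‖) * ⟪T y, y⟫_ℝ * p ^ 2 + (2 + ratio φ ‖y‖) * ⟪T y, e⟫_ℝ * (p * t)
        + ⟪T e, e⟫_ℝ * t ^ 2) := by
  have hswap : ⟪T e, y⟫_ℝ = ⟪T y, e⟫_ℝ := (hT e y).trans (real_inner_comm _ _)
  rw [weightDeriv_smul_add hy (by rw [inner_smul_right, hye, mul_zero])]
  simp only [map_add, map_smul, inner_add_right, real_inner_smul_right, real_inner_comm (T y),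
    real_inner_comm (T e), hswap]
  ring

theorem exists_eq_smul_add_of_inner_eq_zero (y ζ : E) :
    ∃ (p : ℝ) (e : E), ⟪y, e⟫_ℝ = 0 ∧ ζ = p • y + (1 : ℝ) • e := by
  refine ⟨⟪y, ζ⟫_ℝ / ⟪y, y⟫_ℝ, ζ - (⟪y, ζ⟫_ℝ / ⟪y, y⟫_ℝ) • y, ?_, by module⟩
  rcases eq_or_ne y 0 with rfl | hy
  · exact inner_zero_left _
  · rw [inner_sub_right, inner_smul_right, div_mul_cancel₀ _ (inner_self_ne_zero.2 hy), sub_self]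

theorem pointwiseDissipative_iff_forall_inner_eq_zero {φ : ℝ → ℝ} (hφ : IsWeight φ)
    {T : E →ₗ[ℝ] E} (hT : T.IsSymmetric) : PointwiseDissipative φ T ↔
      ∀ y e : E, y ≠ 0 → ⟪y, e⟫_ℝ = 0 → 0 ≤ ⟪T y, y⟫_ℝ ∧ 0 ≤ ⟪T e, e⟫_ℝ ∧
        ((2 + ratio φ ‖y‖) * ⟪T y, e⟫_ℝ) ^ 2 ≤
          4 * ((1 + ratio φ ‖y‖) * ⟪T y, y⟫_ℝ * ⟪T e, e⟫_ℝ) := by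
  have hequiv {y e : E} (hy : y ≠ 0) (hye : ⟪y, e⟫_ℝ = 0) :
      (∀ p t : ℝ, 0 ≤ ⟪weightDeriv φ y (p • y + t • e), T (p • y + t • e)⟫_ℝ) ↔
        0 ≤ ⟪T y, y⟫_ℝ ∧ 0 ≤ ⟪T e, e⟫_ℝ ∧ ((2 + ratio φ ‖y‖) * ⟪T y, e⟫_ℝ) ^ 2 ≤
          4 * ((1 + ratio φ ‖y‖) * ⟪T y, y⟫_ℝ * ⟪T e, e⟫_ℝ) := by
    have hpos := hφ.pos (norm_pos_iff.2 hy)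
    have hratio : 0 < 1 + ratio φ ‖y‖ := by linarith [hφ.neg_one_lt_ratio (norm_pos_iff.2 hy)]
    simp only [inner_weightDeriv_smul_add hT hpos.ne' hye, mul_nonneg_iff_of_pos_left hpos,
      forall_quadratic_nonneg_iff, mul_nonneg_iff_of_pos_left hratio]
  constructor
  · exact fun h y e hy hye => (hequiv hy hye).1 fun p t => h y _ hy
  · intro h y ζ hy
    obtain ⟨p, e, hye, rfl⟩ := exists_eq_smul_add_of_inner_eq_zero y ζ
    exact (hequiv hy hye).2 (h y e hy hye) p 1

theorem pointwiseDissipative_iff {φ : ℝ → ℝ} (hφ : IsWeight φ) {T : E →ₗ[ℝ] E}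
    (hT : T.IsSymmetric) : PointwiseDissipative φ T ↔ (∀ x, 0 ≤ ⟪T x, x⟫_ℝ) ∧
      ∀ x y, ⟪x, y⟫_ℝ = 0 →
        ⟪T x, y⟫_ℝ ^ 2 ≤ (1 - lamInftySq φ) * (⟪T x, x⟫_ℝ * ⟪T y, y⟫_ℝ) := by
  rw [pointwiseDissipative_iff_forall_inner_eq_zero hφ hT]
  constructor
  · intro h
    have hnonneg (x : E) : 0 ≤ ⟪T x, x⟫_ℝ := by
      rcases eq_or_ne x 0 with rfl | hx
      · simp
      · exact (h x 0 hx (inner_zero_right x)).1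
    refine ⟨hnonneg, fun x y hxy => ?_⟩
    rcases eq_or_ne x 0 with rfl | hx
    · simp
    rw [sub_mul, one_mul, le_sub_comm, hφ.lamInftySq_mul_le_iff
      (mul_nonneg (hnonneg x) (hnonneg y))]
    intro s hs
    have hxs : ‖(s / ‖x‖) • x‖ = s := by
      rw [norm_smul, norm_div, norm_norm, Real.norm_of_nonneg hs.le,
        div_mul_cancel₀ _ (norm_ne_zero_iff.2 hx)]
    have hscale : 0 < s / ‖x‖ := div_pos hs (norm_pos_iff.2 hx)
    have := (h ((s / ‖x‖) • x) y (smul_ne_zero hscale.ne' hx)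
      (by rw [real_inner_smul_left, hxy, mul_zero])).2.2
    rw [hφ.ratio_div_sq_mul_le_iff hs]
    simp only [hxs, map_smul, real_inner_smul_left, real_inner_smul_right] at this
    refine le_of_mul_le_mul_left ?_ (pow_pos hscale 2)
    linarith
  · rintro ⟨hnonneg, h⟩ y e hy hye
    refine ⟨hnonneg y, hnonneg e, ?_⟩
    have hnorm := norm_pos_iff.2 hy
    rw [← hφ.ratio_div_sq_mul_le_iff hnorm]
    refine (hφ.lamInftySq_mul_le_iff (mul_nonneg (hnonneg y) (hnonneg e))).1 ?_ _ hnorm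
    linarith [h y e hye]

theorem wielandt_inequality {T : E →ₗ[ℝ] E} (hT : T.IsSymmetric) {α β : ℝ} (hα : 0 ≤ α)
    (hβ : 0 ≤ β) (hlower : ∀ x, α * ‖x‖ ^ 2 ≤ ⟪T x, x⟫_ℝ) (hupper : ∀ x, ⟪T x, x⟫_ℝ ≤ β * ‖x‖ ^ 2)
    {x y : E} (hxy : ⟪x, y⟫_ℝ = 0) :
    ((α + β) * ⟪T x, y⟫_ℝ) ^ 2 ≤ (β - α) ^ 2 * (⟪T x, x⟫_ℝ * ⟪T y, y⟫_ℝ) := by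
  have hswap : ⟪T y, x⟫_ℝ = ⟪T x, y⟫_ℝ := (hT y x).trans (real_inner_comm _ _)
  have hform (s t : ℝ) : ⟪T (s • x + t • y), s • x + t • y⟫_ℝ =
      ⟪T x, x⟫_ℝ * s ^ 2 + 2 * ⟪T x, y⟫_ℝ * (s * t) + ⟪T y, y⟫_ℝ * t ^ 2 := by
    simp only [map_add, map_smul, inner_add_left, inner_add_right, real_inner_smul_left,
      real_inner_smul_right, hswap]
    ring
  have hnorm (s t : ℝ) : ‖s • x + t • y‖ ^ 2 = s ^ 2 * ‖x‖ ^ 2 + t ^ 2 * ‖y‖ ^ 2 := by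
    rw [norm_add_sq_real, real_inner_smul_left, real_inner_smul_right, hxy, norm_smul, norm_smul,
      mul_pow, mul_pow, Real.norm_eq_abs, Real.norm_eq_abs, sq_abs, sq_abs]
    ring
  have hquadratic := forall_quadratic_nonneg_iff.1 fun s t => show
      0 ≤ (β - α) * ⟪T x, x⟫_ℝ * s ^ 2 + 2 * (β + α) * ⟪T x, y⟫_ℝ * (s * t) +
        (β - α) * ⟪T y, y⟫_ℝ * t ^ 2 by
    have hlo := mul_le_mul_of_nonneg_left (hlower (s • x + t • y)) hβ
    have hup := mul_le_mul_of_nonneg_left (hupper (s • x + (-t) • y)) hα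
    rw [hform, hnorm] at hlo hup
    linarith
  linarith [hquadratic.2.2]

/-- With `e`, `f` unit eigenvectors of `α`, `β`, the vectors `e - f` and `e + f` are orthogonal and
attain equality in Wielandt's inequality. -/
theorem sq_sub_le_of_forall_inner_sq_le {T : E →ₗ[ℝ] E} (hT : T.IsSymmetric) {α β c : ℝ}
    (hα : Module.End.HasEigenvalue T α) (hβ : Module.End.HasEigenvalue T β) (hc : 0 ≤ c)
    (h : ∀ x y, ⟪x, y⟫_ℝ = 0 → ⟪T x, y⟫_ℝ ^ 2 ≤ c * (⟪T x, x⟫_ℝ * ⟪T y, y⟫_ℝ)) :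
    (α - β) ^ 2 ≤ c * (α + β) ^ 2 := by
  rcases eq_or_ne α β with rfl | hne
  · rw [sub_self, zero_pow two_ne_zero]
    positivity
  have exists_unit {γ : ℝ} (hγ : Module.End.HasEigenvalue T γ) : ∃ e, T e = γ • e ∧ ‖e‖ = 1 := by
    obtain ⟨v, hv⟩ := hγ.exists_hasEigenvector
    refine ⟨(‖v‖⁻¹ : ℝ) • v, by rw [map_smul, hv.apply_eq_smul, smul_comm], ?_⟩
    exact norm_smul_inv_norm (𝕜 := ℝ) hv.2
  obtain ⟨e, hTe, he⟩ := exists_unit hα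
  obtain ⟨f, hTf, hf⟩ := exists_unit hβ
  have hee : ⟪e, e⟫_ℝ = 1 := by rw [real_inner_self_eq_norm_sq, he, one_pow]
  have hff : ⟪f, f⟫_ℝ = 1 := by rw [real_inner_self_eq_norm_sq, hf, one_pow]
  have hef : ⟪e, f⟫_ℝ = 0 := by
    have := hT e f
    rw [hTe, hTf, real_inner_smul_left, real_inner_smul_right] at this
    exact (mul_eq_zero.1 (by linarith : (α - β) * ⟪e, f⟫_ℝ = 0)).resolve_left (sub_ne_zero.2 hne)
  have hfe : ⟪f, e⟫_ℝ = 0 := (real_inner_comm _ _).trans hef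
  have := h (e - f) (e + f) (by
    simp only [inner_sub_left, inner_add_right, hee, hff, hef, hfe]; norm_num)
  simp only [map_sub, map_add, hTe, hTf, inner_sub_left, inner_add_left, inner_sub_right,
    inner_add_right, real_inner_smul_left, hee, hff, hef, hfe] at this
  linarith

theorem pointwiseDissipative_iff_of_hasEigenvalue {φ : ℝ → ℝ} (hφ : IsWeight φ) {T : E →ₗ[ℝ] E}
    (hT : T.IsSymmetric) {α β : ℝ} (hα : Module.End.HasEigenvalue T α)
    (hβ : Module.End.HasEigenvalue T β) (hlower : ∀ x, α * ‖x‖ ^ 2 ≤ ⟪T x, x⟫_ℝ)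
    (hupper : ∀ x, ⟪T x, x⟫_ℝ ≤ β * ‖x‖ ^ 2) :
    PointwiseDissipative φ T ↔ 0 ≤ α ∧ lamInftySq φ * (α + β) ^ 2 ≤ 4 * (α * β) := by
  obtain ⟨e, he⟩ := hα.exists_hasEigenvector
  have henorm : 0 < ‖e‖ ^ 2 := pow_pos (norm_pos_iff.2 he.2) 2
  have hTe : ⟪T e, e⟫_ℝ = α * ‖e‖ ^ 2 := by
    rw [he.apply_eq_smul, real_inner_smul_left, real_inner_self_eq_norm_sq]
  rw [pointwiseDissipative_iff hφ hT]
  constructor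
  · rintro ⟨hnonneg, h⟩
    have := sq_sub_le_of_forall_inner_sq_le hT hα hβ (sub_nonneg.2 hφ.lamInftySq_le_one) h
    exact ⟨nonneg_of_mul_nonneg_left (hTe ▸ hnonneg e) henorm, by linarith⟩
  · rintro ⟨hα0, hle⟩
    have hαβ : α ≤ β := le_of_mul_le_mul_right (hTe ▸ hupper e) henorm
    have hnonneg (x : E) : 0 ≤ ⟪T x, x⟫_ℝ := (by positivity : 0 ≤ α * ‖x‖ ^ 2).trans (hlower x)
    refine ⟨hnonneg, fun x y hxy => ?_⟩
    have hwielandt := wielandt_inequality hT hα0 (hα0.trans hαβ) hlower hupper hxy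
    rcases (add_nonneg hα0 (hα0.trans hαβ)).eq_or_lt with hzero | hpos
    · obtain rfl : β = 0 := by linarith
      have hT0 : T = 0 := hT.inner_map_self_eq_zero.1 fun x =>
        le_antisymm ((hupper x).trans_eq (zero_mul _)) (hnonneg x)
      simp [hT0]
    · refine le_of_mul_le_mul_left ?_ (pow_pos hpos 2)
      linarith [mul_le_mul_of_nonneg_right hle (mul_nonneg (hnonneg x) (hnonneg y))]

end PointwiseDissipative

section Eigenvalues

open scoped Pointwise ComplexOrder

variable {m : ℕ} {M : Matrix (Fin m) (Fin m) ℝ}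

theorem eigenvalueSet_eq_spectrum (M : Matrix (Fin m) (Fin m) ℝ) :
    eigenvalueSet M = spectrum ℝ M := by
  ext c
  rw [← Matrix.spectrum_toLin', ← Module.End.hasEigenvalue_iff_mem_spectrum]
  rfl

theorem finite_eigenvalueSet (M : Matrix (Fin m) (Fin m) ℝ) : (eigenvalueSet M).Finite :=
  Module.End.finite_hasEigenvalue _

theorem eigenvalueSet_eq_range_eigenvalues (hM : M.IsHermitian) :
    eigenvalueSet M = range hM.eigenvalues :=
  (eigenvalueSet_eq_spectrum M).trans hM.spectrum_real_eq_range_eigenvalues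

theorem nonempty_eigenvalueSet (hm : 1 ≤ m) (hM : M.IsHermitian) : (eigenvalueSet M).Nonempty :=
  eigenvalueSet_eq_range_eigenvalues hM ▸ ⟨_, mem_range_self ⟨0, hm⟩⟩

theorem eigMin_mem (hm : 1 ≤ m) (hM : M.IsHermitian) : eigMin M ∈ eigenvalueSet M :=
  (nonempty_eigenvalueSet hm hM).csInf_mem (finite_eigenvalueSet M)

theorem eigMax_mem (hm : 1 ≤ m) (hM : M.IsHermitian) : eigMax M ∈ eigenvalueSet M :=
  (nonempty_eigenvalueSet hm hM).csSup_mem (finite_eigenvalueSet M)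

theorem eigMin_le {c : ℝ} (hc : c ∈ eigenvalueSet M) : eigMin M ≤ c :=
  csInf_le (finite_eigenvalueSet M).bddBelow hc

theorem le_eigMax {c : ℝ} (hc : c ∈ eigenvalueSet M) : c ≤ eigMax M :=
  le_csSup (finite_eigenvalueSet M).bddAbove hc

theorem eigenvalueSet_sub_smul_one (M : Matrix (Fin m) (Fin m) ℝ) (κ : ℝ) :
    eigenvalueSet (M - κ • 1) = eigenvalueSet M - {κ} := by
  rw [eigenvalueSet_eq_spectrum, eigenvalueSet_eq_spectrum, spectrum.sub_singleton_eq,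
    Algebra.algebraMap_eq_smul_one]

theorem eigMin_sub_smul_one (hm : 1 ≤ m) (hM : M.IsHermitian) (κ : ℝ) :
    eigMin (M - κ • 1) = eigMin M - κ := by
  rw [eigMin, eigenvalueSet_sub_smul_one, csInf_sub (nonempty_eigenvalueSet hm hM)
    (finite_eigenvalueSet M).bddBelow (singleton_nonempty κ) bddAbove_singleton, csSup_singleton]
  rfl

theorem eigMax_sub_smul_one (hm : 1 ≤ m) (hM : M.IsHermitian) (κ : ℝ) :
    eigMax (M - κ • 1) = eigMax M - κ := by
  rw [eigMax, eigenvalueSet_sub_smul_one, csSup_sub (nonempty_eigenvalueSet hm hM)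
    (finite_eigenvalueSet M).bddAbove (singleton_nonempty κ) bddBelow_singleton, csInf_singleton]
  rfl

theorem exists_mulVec_dotProduct_eq {c : ℝ} (hc : c ∈ eigenvalueSet M) :
    ∃ v : Fin m → ℝ, v ≠ 0 ∧ M.mulVec v ⬝ᵥ v = c * (v ⬝ᵥ v) := by
  obtain ⟨v, hv⟩ := Module.End.HasEigenvalue.exists_hasEigenvector hc
  have hMv : M.mulVec v = c • v := hv.apply_eq_smul
  exact ⟨v, hv.2, by rw [hMv, smul_dotProduct, smul_eq_mul]⟩

theorem eigMin_pos (hm : 1 ≤ m) (hM : M.IsHermitian)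
    (hpos : ∀ ξ : Fin m → ℝ, ξ ≠ 0 → 0 < M.mulVec ξ ⬝ᵥ ξ) : 0 < eigMin M := by
  obtain ⟨v, hv, hMv⟩ := exists_mulVec_dotProduct_eq (eigMin_mem hm hM)
  exact pos_of_mul_pos_left (hMv ▸ hpos v hv) (dotProduct_self_star_nonneg v)

theorem eigMax_le_of_forall (hm : 1 ≤ m) (hM : M.IsHermitian) {C : ℝ}
    (hC : ∀ ξ : Fin m → ℝ, M.mulVec ξ ⬝ᵥ ξ ≤ C * (ξ ⬝ᵥ ξ)) : eigMax M ≤ C := by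
  obtain ⟨v, hv, hMv⟩ := exists_mulVec_dotProduct_eq (eigMax_mem hm hM)
  exact le_of_mul_le_mul_right (hMv ▸ hC v) (Matrix.dotProduct_star_self_pos_iff.2 hv)

theorem eigenvalueSet_fin_two {M : Matrix (Fin 2) (Fin 2) ℝ} (hM : M.IsHermitian) :
    eigenvalueSet M = {hM.eigenvalues 0, hM.eigenvalues 1} := by
  rw [eigenvalueSet_eq_range_eigenvalues hM]
  ext c
  simp [Fin.exists_fin_two, eq_comm]

theorem eigMin_mul_eigMax_eq_det {M : Matrix (Fin 2) (Fin 2) ℝ} (hM : M.IsHermitian) :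
    eigMin M * eigMax M = M.det := by
  rw [eigMin, eigMax, eigenvalueSet_fin_two hM, csInf_pair, csSup_pair, min_mul_max,
    hM.det_eq_prod_eigenvalues, Fin.prod_univ_two]
  rfl

theorem eigMin_add_eigMax_eq_trace {M : Matrix (Fin 2) (Fin 2) ℝ} (hM : M.IsHermitian) :
    eigMin M + eigMax M = M.trace := by
  rw [eigMin, eigMax, eigenvalueSet_fin_two hM, csInf_pair, csSup_pair, min_add_max,
    hM.trace_eq_sum_eigenvalues, Fin.sum_univ_two]
  rfl

theorem posSemidef_of_forall_mem_eigenvalueSet (hM : M.IsHermitian)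
    (hnonneg : ∀ c ∈ eigenvalueSet M, 0 ≤ c) : M.PosSemidef :=
  hM.posSemidef_iff_eigenvalues_nonneg.2 fun i =>
    hnonneg _ (eigenvalueSet_eq_range_eigenvalues hM ▸ mem_range_self i)

theorem posSemidef_sub_eigMin_smul_one (hM : M.IsHermitian) : (M - eigMin M • 1).PosSemidef := by
  refine posSemidef_of_forall_mem_eigenvalueSet
    (hM.sub (Matrix.isHermitian_one.smul (IsSelfAdjoint.all _))) fun c hc => ?_
  rw [eigenvalueSet_sub_smul_one, sub_singleton] at hc
  obtain ⟨d, hd, rfl⟩ := hc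
  exact sub_nonneg.2 (eigMin_le hd)

theorem posSemidef_eigMax_smul_one_sub (hM : M.IsHermitian) : (eigMax M • 1 - M).PosSemidef := by
  refine posSemidef_of_forall_mem_eigenvalueSet
    ((Matrix.isHermitian_one.smul (IsSelfAdjoint.all _)).sub hM) fun c hc => ?_
  rw [eigenvalueSet_eq_spectrum, ← Algebra.algebraMap_eq_smul_one, ← spectrum.singleton_sub_eq,
    ← eigenvalueSet_eq_spectrum, singleton_sub] at hc
  obtain ⟨d, hd, rfl⟩ := hc
  exact sub_nonneg.2 (le_eigMax hd)

theorem posSemidef_map_ofReal (hM : M.PosSemidef) : (M.map Complex.ofReal).PosSemidef := by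
  obtain ⟨n, v, rfl⟩ := Matrix.posSemidef_iff_eq_sum_vecMulVec.1 hM
  have hmap : (∑ i, Matrix.vecMulVec (v i) (star (v i))).map Complex.ofReal =
      ∑ i, Matrix.vecMulVec (fun j => (v i j : ℂ)) (star fun j => (v i j : ℂ)) := by
    ext j k
    simp [Matrix.sum_apply, Matrix.vecMulVec_apply]
  rw [hmap]
  exact Matrix.posSemidef_sum _ fun i _ => Matrix.posSemidef_vecMulVec_self_star _

end Eigenvalues

section RealLin

open scoped ComplexOrder

variable {m : ℕ}

/-- The real linear map of `ℂᵐ` given by a complex matrix; the real part of the Hermitian product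
is the inner product of `ℂᵐ` as a real space. -/
noncomputable def realLin (B : Matrix (Fin m) (Fin m) ℂ) :
    EuclideanSpace ℂ (Fin m) →ₗ[ℝ] EuclideanSpace ℂ (Fin m) :=
  (Matrix.toEuclideanLin B).restrictScalars ℝ

theorem re_inner_eq_real_inner (x y : EuclideanSpace ℂ (Fin m)) :
    (⟪x, y⟫_ℂ).re = ⟪x, y⟫_ℝ := by
  simp [PiLp.inner_apply, Complex.re_sum]

theorem isSymmetric_realLin {B : Matrix (Fin m) (Fin m) ℂ} (hB : B.IsHermitian) :
    (realLin B).IsSymmetric := fun x y => by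
  have hsymm := congrArg Complex.re (Matrix.isSymmetric_toEuclideanLin_iff.2 hB x y)
  rwa [re_inner_eq_real_inner, re_inner_eq_real_inner] at hsymm

theorem real_inner_realLin_nonneg {B : Matrix (Fin m) (Fin m) ℂ} (hB : B.PosSemidef)
    (x : EuclideanSpace ℂ (Fin m)) : 0 ≤ ⟪realLin B x, x⟫_ℝ := by
  rw [← re_inner_eq_real_inner]
  exact (Matrix.isPositive_toEuclideanLin_iff.2 hB).2 x

variable {M : Matrix (Fin m) (Fin m) ℝ}

theorem isHermitian_map_ofReal (hM : M.IsHermitian) : (M.map Complex.ofReal).IsHermitian :=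
  hM.map _ fun r => (Complex.conj_ofReal r).symm

theorem realLin_map_sub (M N : Matrix (Fin m) (Fin m) ℝ) (x : EuclideanSpace ℂ (Fin m)) :
    realLin ((M - N).map Complex.ofReal) x =
      realLin (M.map Complex.ofReal) x - realLin (N.map Complex.ofReal) x := by
  rw [Matrix.map_sub _ Complex.ofReal_sub]
  simp [realLin]

theorem realLin_map_smul_one (c : ℝ) (x : EuclideanSpace ℂ (Fin m)) :
    realLin ((c • 1 : Matrix (Fin m) (Fin m) ℝ).map Complex.ofReal) x = c • x := by
  have hmap : (c • 1 : Matrix (Fin m) (Fin m) ℝ).map Complex.ofReal = (c : ℂ) • 1 := by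
    ext i j
    by_cases hij : i = j <;> simp [hij]
  rw [hmap, realLin, map_smul, Matrix.toLpLin_one]
  exact Complex.coe_smul c x

theorem eigMin_mul_sq_norm_le (hM : M.IsHermitian) (x : EuclideanSpace ℂ (Fin m)) :
    eigMin M * ‖x‖ ^ 2 ≤ ⟪realLin (M.map Complex.ofReal) x, x⟫_ℝ := by
  have hnonneg := real_inner_realLin_nonneg
    (posSemidef_map_ofReal (posSemidef_sub_eigMin_smul_one hM)) x
  rwa [realLin_map_sub, realLin_map_smul_one, inner_sub_left, real_inner_smul_left,
    real_inner_self_eq_norm_sq, sub_nonneg] at hnonneg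

theorem le_eigMax_mul_sq_norm (hM : M.IsHermitian) (x : EuclideanSpace ℂ (Fin m)) :
    ⟪realLin (M.map Complex.ofReal) x, x⟫_ℝ ≤ eigMax M * ‖x‖ ^ 2 := by
  have hnonneg := real_inner_realLin_nonneg
    (posSemidef_map_ofReal (posSemidef_eigMax_smul_one_sub hM)) x
  rwa [realLin_map_sub, realLin_map_smul_one, inner_sub_left, real_inner_smul_left,
    real_inner_self_eq_norm_sq, sub_nonneg] at hnonneg

theorem hasEigenvalue_realLin_map {c : ℝ} (hc : c ∈ eigenvalueSet M) :
    Module.End.HasEigenvalue (realLin (M.map Complex.ofReal)) c := by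
  obtain ⟨v, hv⟩ := Module.End.HasEigenvalue.exists_hasEigenvector hc
  have hMv : M.mulVec v = c • v := hv.apply_eq_smul
  refine Module.End.hasEigenvalue_of_hasEigenvector
    (x := WithLp.toLp 2 fun i => (v i : ℂ)) (Module.End.hasEigenvector_iff.2 ⟨?_, fun h => hv.2 ?_⟩)
  · rw [Module.End.mem_eigenspace_iff]
    ext i
    have hi := congrArg Complex.ofReal (congrFun hMv i)
    simpa [realLin, Matrix.mulVec, dotProduct] using hi
  · ext i
    simpa using congrArg (fun w : EuclideanSpace ℂ (Fin m) => w i) h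

variable {φ : ℝ → ℝ}

theorem pointwiseDissipative_map_iff (hφ : IsWeight φ) (hm : 1 ≤ m) (hM : M.IsHermitian) :
    PointwiseDissipative φ (realLin (M.map Complex.ofReal)) ↔
      0 ≤ eigMin M ∧ lamInftySq φ * (eigMin M + eigMax M) ^ 2 ≤ 4 * (eigMin M * eigMax M) :=
  pointwiseDissipative_iff_of_hasEigenvalue hφ (isSymmetric_realLin (isHermitian_map_ofReal hM))
    (hasEigenvalue_realLin_map (eigMin_mem hm hM)) (hasEigenvalue_realLin_map (eigMax_mem hm hM))
    (eigMin_mul_sq_norm_le hM) (le_eigMax_mul_sq_norm hM)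

theorem pointwiseDissipative_shifted_iff (hφ : IsWeight φ) (hm : 1 ≤ m)
    {𝓐 : ℝ → Matrix (Fin m) (Fin m) ℝ} {x : ℝ} (hA : (𝓐 x).IsHermitian) (κ : ℝ) :
    PointwiseDissipative φ (realLin (shifted 𝓐 κ x)) ↔
      κ ≤ eigMin (𝓐 x) ∧
        (1 - lamInftySq φ) * (κ * (eigMin (𝓐 x) + eigMax (𝓐 x) - κ)) ≤
          eigMin (𝓐 x) * eigMax (𝓐 x) -
            lamInftySq φ / 4 * (eigMin (𝓐 x) + eigMax (𝓐 x)) ^ 2 := by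
  have hshift : (𝓐 x - κ • 1).IsHermitian :=
    hA.sub (Matrix.isHermitian_one.smul (IsSelfAdjoint.all _))
  rw [shifted, pointwiseDissipative_map_iff hφ hm hshift, eigMin_sub_smul_one hm hA,
    eigMax_sub_smul_one hm hA, sub_nonneg]
  exact and_congr_right fun _ => by constructor <;> intro h <;> linarith

end RealLin

section WeightDeriv

variable {E : Type*} [NormedAddCommGroup E] [InnerProductSpace ℝ E] {φ : ℝ → ℝ}

theorem weightDeriv_smul (φ : ℝ → ℝ) (y ζ : E) (c : ℝ) :
    weightDeriv φ y (c • ζ) = c • weightDeriv φ y ζ := by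
  rw [weightDeriv, weightDeriv, inner_smul_right]
  module

theorem hasDerivAt_norm {u : ℝ → E} {u' : E} {x : ℝ} (hu : HasDerivAt u u' x)
    (hx : u x ≠ 0) : HasDerivAt (fun t => ‖u t‖) (⟪u x, u'⟫_ℝ / ‖u x‖) x := by
  have hsqrt := hu.norm_sq.sqrt (by positivity)
  simp only [Real.sqrt_sq (norm_nonneg _), mul_div_mul_left _ _ (two_ne_zero' ℝ)] at hsqrt
  exact hsqrt

namespace IsWeight

variable (hφ : IsWeight φ)
include hφ

theorem hasDerivAt_smul {u : ℝ → E} {u' : E} {x : ℝ} (hu : HasDerivAt u u' x) (hx : u x ≠ 0) :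
    HasDerivAt (fun t => φ ‖u t‖ • u t) (weightDeriv φ (u x) u') x :=
  ((hφ.differentiableAt (norm_pos_iff.2 hx)).hasDerivAt.comp x
    (hasDerivAt_norm hu hx)).smul hu

theorem contDiffAt_smul {u : ℝ → E} {x : ℝ} (hu : ContDiffAt ℝ 1 u x) (hx : u x ≠ 0) :
    ContDiffAt ℝ 1 (fun t => φ ‖u t‖ • u t) x :=
  ((hφ.contDiffAt (norm_pos_iff.2 hx)).comp x (hu.norm ℝ hx)).smul hu

theorem continuousOn_weightDeriv :
    ContinuousOn (fun p : E × E => weightDeriv φ p.1 p.2) {p | p.1 ≠ 0} := by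
  have hnorm : ContinuousOn (fun p : E × E => ‖p.1‖) {p | p.1 ≠ 0} := by fun_prop
  have hmaps : MapsTo (fun p : E × E => ‖p.1‖) {p | p.1 ≠ 0} (Ioi 0) :=
    fun p hp => norm_pos_iff.2 hp
  have hderiv : ContinuousOn (deriv φ) (Ioi 0) := fun s hs =>
    (hφ.continuousAt_deriv hs).continuousWithinAt
  exact ((hφ.contDiffOn.continuousOn.comp hnorm hmaps).smul continuousOn_snd).add
    (((hderiv.comp hnorm hmaps).mul
      ((continuous_fst.inner continuous_snd).continuousOn.div hnorm
        fun p hp => norm_ne_zero_iff.2 hp)).smul continuousOn_fst)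

end IsWeight

end WeightDeriv

section Integrability

theorem ae_deriv_eq_zero_of_eq {E : Type*} [NormedAddCommGroup E] [NormedSpace ℝ E] (u : ℝ → E)
    (c : E) : ∀ᵐ x : ℝ, u x = c → deriv u x = 0 := by
  have hisolated : {x | u x = c ∧ deriv u x ≠ 0} ⊆
      {x ∈ {x | u x = c} | 𝓝[{x | u x = c} ∩ Ioi x] x = ⊥} := by
    rintro x ⟨hx, hderiv⟩
    refine ⟨hx, ?_⟩
    have hne : ∀ᶠ z in 𝓝[>] x, u z ≠ c :=
      ((differentiableAt_of_deriv_ne_zero hderiv).hasDerivAt.eventually_ne hderiv).filter_mono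
        (nhdsWithin_mono x fun z hz => ne_of_gt hz)
    rw [inter_comm, nhdsWithin_inter', ← disjoint_iff, disjoint_principal_right]
    exact hne
  filter_upwards [(countable_setOfPred_isolated_right_within.mono hisolated).ae_notMem volume]
    with x hx hu
  exact not_not.1 fun hderiv => hx ⟨hu, hderiv⟩

theorem integrableOn_inner {𝕜 E : Type*} [RCLike 𝕜] [NormedAddCommGroup E]
    [InnerProductSpace 𝕜 E] {I : Set ℝ} (hI : MeasurableSet I) {f β : ℝ → E}
    (hβ : LocallyIntegrableOn β I) (hf : Continuous f) (hfc : HasCompactSupport f)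
    (hfI : tsupport f ⊆ I) : IntegrableOn (fun x => inner 𝕜 (f x) (β x)) I := by
  obtain ⟨C, hC⟩ := hfc.exists_bound_of_continuous hf
  have hβf : IntegrableOn β (tsupport f) := hβ.integrableOn_compact_subset hfI hfc
  have hsupport : IntegrableOn (fun x => inner 𝕜 (f x) (β x)) (tsupport f) :=
    (hβf.norm.const_mul C).mono' (hf.aestronglyMeasurable.inner hβf.aestronglyMeasurable) <|
      .of_forall fun x =>
        (norm_inner_le_norm _ _).trans (mul_le_mul_of_nonneg_right (hC x) (norm_nonneg _))
  refine hsupport.of_forall_sdiff_eq_zero hI fun x hx => ?_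
  rw [image_eq_zero_of_notMem_tsupport hx.2, inner_zero_left]

variable {m : ℕ} {I : Set ℝ} {𝓑 : ℝ → Matrix (Fin m) (Fin m) ℂ}

theorem locallyIntegrableOn_realLin (hI : IsOpen I)
    (h𝓑 : ∀ i j, LocallyIntegrableOn (fun x => 𝓑 x i j) I) {g : ℝ → EuclideanSpace ℂ (Fin m)}
    (hg : Continuous g) : LocallyIntegrableOn (fun x => realLin (𝓑 x) (g x)) I := by
  have hsum : (fun x => realLin (𝓑 x) (g x)) =
      fun x => ∑ i, ∑ j, (𝓑 x i j * g x j) • EuclideanSpace.single i (1 : ℂ) := by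
    funext x
    ext i
    simp [realLin, Matrix.mulVec, dotProduct, Finset.sum_apply, Pi.single_apply, apply_ite]
  rw [hsum, locallyIntegrableOn_iff hI.isLocallyClosed]
  refine fun K hKI hK => integrable_finsetSum _ fun i _ => integrable_finsetSum _ fun j _ =>
    Integrable.smul_const ?_ _
  exact ((h𝓑 i j).integrableOn_compact_subset hKI hK).mul_continuousOn
    (by fun_prop) hK

end Integrability

section EnergyDensity

variable {m : ℕ} {I : Set ℝ} {φ : ℝ → ℝ} {𝓑 : ℝ → Matrix (Fin m) (Fin m) ℂ}

/-- The integrand `Re ⟨𝓑 u', (φ(|u|) u)'⟩` of the definition of `L^Φ`-dissipativity, as a real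
inner product. -/
noncomputable def energyDensity (φ : ℝ → ℝ) (𝓑 : ℝ → Matrix (Fin m) (Fin m) ℂ)
    (u : ℝ → EuclideanSpace ℂ (Fin m)) (x : ℝ) : ℝ :=
  ⟪deriv (fun t => φ ‖u t‖ • u t) x, realLin (𝓑 x) (deriv u x)⟫_ℝ

theorem lPhiDissipative_iff_setIntegral_energyDensity_nonneg (hI : IsOpen I)
    (h𝓑 : ∀ i j, LocallyIntegrableOn (fun x => 𝓑 x i j) I) :
    LPhiDissipative φ I 𝓑 ↔ ∀ u : ℝ → EuclideanSpace ℂ (Fin m), IsTest I u →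
      IsTest I (fun x => φ ‖u x‖ • u x) → 0 ≤ ∫ x in I, energyDensity φ 𝓑 u x := by
  refine forall₃_congr fun u hu hv => ?_
  have hintegrable := integrableOn_inner (𝕜 := ℂ) hI.measurableSet
    (locallyIntegrableOn_realLin hI h𝓑 (hu.1.continuous_deriv le_rfl))
    (hv.1.continuous_deriv le_rfl) hv.2.1.deriv (tsupport_deriv_subset.trans hv.2.2)
  have hre : ∫ x in I, energyDensity φ 𝓑 u x = (∫ x in I, inner ℂ
      (deriv (fun y => φ ‖u y‖ • u y) x) (Matrix.toEuclideanLin (𝓑 x) (deriv u x))).re := by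
    simp only [energyDensity, ← re_inner_eq_real_inner]
    exact integral_re hintegrable
  rw [hre]

theorem lPhiDissipative_of_ae_pointwiseDissipative (hφ : IsWeight φ) (hI : IsOpen I)
    (h𝓑 : ∀ i j, LocallyIntegrableOn (fun x => 𝓑 x i j) I)
    (h : ∀ᵐ x ∂volume.restrict I, PointwiseDissipative φ (realLin (𝓑 x))) :
    LPhiDissipative φ I 𝓑 := by
  refine (lPhiDissipative_iff_setIntegral_energyDensity_nonneg hI h𝓑).2 fun u hu _ =>
    integral_nonneg_of_ae ?_
  filter_upwards [h, ae_restrict_of_ae (ae_deriv_eq_zero_of_eq u 0)] with x hdiss hzero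
  by_cases hux : u x = 0
  · rw [energyDensity, hzero hux, map_zero, inner_zero_right, Pi.zero_apply]
  · rw [energyDensity, (hφ.hasDerivAt_smul
      (hu.1.differentiable one_ne_zero x).hasDerivAt hux).deriv]
    exact hdiss (u x) (deriv u x) hux

end EnergyDensity

section Cutoff

open scoped Manifold ContDiff

variable {I K : Set ℝ}

theorem exists_contDiff_eq_one_iff_mem (hI : IsOpen I) (hK : IsCompact K) (hKI : K ⊆ I) :
    ∃ ρ : ℝ → ℝ, ContDiff ℝ 1 ρ ∧ HasCompactSupport ρ ∧ tsupport ρ ⊆ I ∧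
      (∀ x, ρ x ∈ Icc 0 1) ∧ ∀ x, ρ x = 1 ↔ x ∈ K := by
  obtain ⟨L, hL, hKL, hLI⟩ := exists_compact_between hK hI hKI
  obtain ⟨ρ, hρ, hrange, hsupport, hone⟩ := exists_contMDiff_support_eq_eq_one_iff 𝓘(ℝ, ℝ)
    (isOpen_interior (s := L)) hK.isClosed hKL
  have htsupport : tsupport ρ ⊆ L :=
    closure_minimal (hsupport.subset.trans interior_subset) hL.isClosed
  exact ⟨ρ, hρ.contDiff.of_le (mod_cast le_top),
    hL.of_isClosed_subset (isClosed_tsupport ρ) htsupport, htsupport.trans hLI,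
    fun x => hrange (mem_range_self x), fun x => (hone x).symm⟩

theorem exists_contDiff_eventuallyEq_one (hI : IsOpen I) (hK : IsCompact K) (hKI : K ⊆ I) :
    ∃ ρ : ℝ → ℝ, ContDiff ℝ 1 ρ ∧ HasCompactSupport ρ ∧ tsupport ρ ⊆ I ∧ (∀ x, 0 ≤ ρ x) ∧
      ∀ x ∈ K, ρ =ᶠ[𝓝 x] 1 := by
  obtain ⟨L, hL, hKL, hLI⟩ := exists_compact_between hK hI hKI
  obtain ⟨ρ, hρ, hcompact, hsupport, hrange, hone⟩ := exists_contDiff_eq_one_iff_mem hI hL hLI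
  refine ⟨ρ, hρ, hcompact, hsupport, fun x => (hrange x).1, fun x hx => ?_⟩
  filter_upwards [isOpen_interior.mem_nhds (hKL hx)] with t ht
  exact (hone t).2 (interior_subset ht)

theorem integrableOn_mul {f ρ : ℝ → ℝ} (hI : MeasurableSet I) (hf : LocallyIntegrableOn f I)
    (hρ : Continuous ρ) (hρc : HasCompactSupport ρ) (hρI : tsupport ρ ⊆ I) :
    IntegrableOn (fun x => ρ x * f x) I := by
  simpa only [RCLike.inner_apply', conj_trivial] using
    integrableOn_inner (𝕜 := ℝ) hI hf hρ hρc hρI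

theorem setIntegral_nonneg_of_forall_sq_mul {f : ℝ → ℝ} (hI : IsOpen I)
    (hf : LocallyIntegrableOn f I) (hK : IsCompact K) (hKI : K ⊆ I)
    (h : ∀ ψ : ℝ → ℝ, ContDiff ℝ 1 ψ → HasCompactSupport ψ → tsupport ψ ⊆ I →
      0 ≤ ∫ x in I, ψ x ^ 2 * f x) : 0 ≤ ∫ x in K, f x := by
  obtain ⟨ρ, hρ, hcompact, hsupport, hrange, hone⟩ := exists_contDiff_eq_one_iff_mem hI hK hKI
  have htsupport (n : ℕ) : tsupport (fun x => ρ x ^ (n + 1)) ⊆ tsupport ρ :=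
    closure_mono fun x hx => ne_zero_pow n.succ_ne_zero hx
  have hnonneg (n : ℕ) : 0 ≤ ∫ x in I, (ρ x ^ (n + 1)) ^ 2 * f x :=
    h _ (hρ.pow _) (hcompact.of_isClosed_subset (isClosed_tsupport _) (htsupport n))
      ((htsupport n).trans hsupport)
  have hlim : Tendsto (fun n : ℕ => ∫ x in I, (ρ x ^ (n + 1)) ^ 2 * f x) atTop
      (𝓝 (∫ x in I, K.indicator f x)) := by
    refine tendsto_integral_of_dominated_convergence (fun x => ρ x * ‖f x‖) (fun n => ?_)
      (integrableOn_mul hI.measurableSet hf.norm hρ.continuous hcompact hsupport) (fun n => ?_) ?_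
    · exact ((hρ.continuous.pow _).pow 2).aestronglyMeasurable.mul hf.aestronglyMeasurable
    · refine .of_forall fun x => ?_
      rw [norm_mul, ← pow_mul, Real.norm_of_nonneg (pow_nonneg (hrange x).1 _)]
      exact mul_le_mul_of_nonneg_right
        (pow_le_of_le_one (hrange x).1 (hrange x).2 (by positivity)) (norm_nonneg _)
    · refine .of_forall fun x => ?_
      by_cases hx : x ∈ K
      · simp [(hone x).2 hx, hx]
      · have hpow := ((tendsto_pow_atTop_nhds_zero_of_lt_one (hrange x).1
          ((hrange x).2.lt_of_ne (mt (hone x).1 hx))).comp (tendsto_add_atTop_nat 1)).pow 2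
        simpa [hx] using hpow.mul_const (f x)
  rw [setIntegral_indicator hK.measurableSet, inter_eq_self_of_subset_right hKI] at hlim
  exact ge_of_tendsto' hlim hnonneg

theorem ae_nonneg_of_forall_setIntegral_compact {f : ℝ → ℝ} (hI : IsOpen I)
    (hf : LocallyIntegrableOn f I) (h : ∀ K ⊆ I, IsCompact K → 0 ≤ ∫ x in K, f x) :
    ∀ᵐ x ∂volume.restrict I, 0 ≤ f x := by
  by_contra hneg
  obtain ⟨S, hSneg, hS, hSae⟩ := (nullMeasurableSet_lt hf.aestronglyMeasurable.aemeasurable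
    (aemeasurable_const (b := (0 : ℝ)))).exists_measurable_subset_ae_eq
  have hSpos : 0 < volume (S ∩ I) := by
    rw [← Measure.restrict_apply hS, measure_congr hSae, pos_iff_ne_zero]
    simpa only [ae_iff, not_le] using hneg
  obtain ⟨K, hKS, hK, hKpos⟩ := (hS.inter hI.measurableSet).exists_lt_isCompact hSpos
  have hKI : K ⊆ I := hKS.trans inter_subset_right
  have hKneg : ∀ x ∈ K, f x < 0 := fun x hx => hSneg (hKS hx).1
  have hint : 0 < ∫ x in K, (-f) x := by
    rw [setIntegral_pos_iff_support_of_nonneg_ae _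
      (hf.integrableOn_compact_subset hKI hK).neg, inter_eq_self_of_subset_right]
    · exact hKpos
    · exact fun x hx => (neg_pos.2 (hKneg x hx)).ne'
    · filter_upwards [ae_restrict_mem hK.measurableSet] with x hx
      exact neg_nonneg.2 (hKneg x hx).le
  simp only [Pi.neg_apply, integral_neg] at hint
  linarith [h K hKI hK]

theorem ae_nonneg_of_forall_setIntegral_sq_mul {f : ℝ → ℝ} (hI : IsOpen I)
    (hf : LocallyIntegrableOn f I)
    (h : ∀ ψ : ℝ → ℝ, ContDiff ℝ 1 ψ → HasCompactSupport ψ → tsupport ψ ⊆ I →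
      0 ≤ ∫ x in I, ψ x ^ 2 * f x) : ∀ᵐ x ∂volume.restrict I, 0 ≤ f x :=
  ae_nonneg_of_forall_setIntegral_compact hI hf fun _ hKI hK =>
    setIntegral_nonneg_of_forall_sq_mul hI hf hK hKI h

end Cutoff

section Oscillation

/-- A fast oscillation of small amplitude with envelope `ψ`, phase `p`, frequency `n ^ 2` and
amplitude `1 / n`, so that it tends to zero uniformly while its derivative has size `n`. -/
noncomputable def wave (ψ : ℝ → ℝ) (p : ℝ) (n : ℕ) (x : ℝ) : ℝ :=
  ψ x * Real.sin (n ^ 2 * x + p) / n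

/-- The derivative of `wave ψ p n` divided by `n`, which stays bounded as `n` grows. -/
noncomputable def waveSlope (ψ : ℝ → ℝ) (p : ℝ) (n : ℕ) (x : ℝ) : ℝ :=
  deriv ψ x * Real.sin (n ^ 2 * x + p) / n ^ 2 + ψ x * Real.cos (n ^ 2 * x + p)

variable {ψ : ℝ → ℝ}

theorem contDiff_wave (hψ : ContDiff ℝ 1 ψ) (p : ℝ) (n : ℕ) : ContDiff ℝ 1 (wave ψ p n) := by
  unfold wave
  fun_prop

theorem continuous_waveSlope (hψ : ContDiff ℝ 1 ψ) (p : ℝ) (n : ℕ) :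
    Continuous (waveSlope ψ p n) := by
  have : Continuous (deriv ψ) := hψ.continuous_deriv le_rfl
  have : Continuous ψ := hψ.continuous
  unfold waveSlope
  fun_prop

theorem tsupport_wave_subset (ψ : ℝ → ℝ) (p : ℝ) (n : ℕ) : tsupport (wave ψ p n) ⊆ tsupport ψ :=
  closure_mono fun x hx h => hx (by simp [wave, h])

theorem tsupport_waveSlope_subset (ψ : ℝ → ℝ) (p : ℝ) (n : ℕ) :
    tsupport (waveSlope ψ p n) ⊆ tsupport ψ :=
  closure_minimal (fun x hx => not_imp_comm.1 (fun h => by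
    rw [waveSlope, image_eq_zero_of_notMem_tsupport h,
      image_eq_zero_of_notMem_tsupport (mt (@tsupport_deriv_subset _ _ _ _ _ ψ x) h)]
    simp) hx) (isClosed_tsupport ψ)

theorem abs_wave_le (ψ : ℝ → ℝ) (p : ℝ) (n : ℕ) (x : ℝ) : |wave ψ p n x| ≤ |ψ x| / n := by
  rw [wave, abs_div, abs_mul, Nat.abs_cast]
  gcongr
  exact mul_le_of_le_one_right (abs_nonneg _) (Real.abs_sin_le_one _)

theorem tendsto_wave (ψ : ℝ → ℝ) (p x : ℝ) : Tendsto (fun n => wave ψ p n x) atTop (𝓝 0) :=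
  squeeze_zero_norm (fun n => abs_wave_le ψ p n x) (tendsto_const_div_atTop_nhds_zero_nat _)

theorem eventually_forall_abs_wave_lt (hψ : Continuous ψ) (hψc : HasCompactSupport ψ) {η : ℝ}
    (hη : 0 < η) : ∀ᶠ n in atTop, ∀ p x, |wave ψ p n x| < η := by
  obtain ⟨M, hM⟩ := hψc.exists_bound_of_continuous hψ
  filter_upwards [(tendsto_const_div_atTop_nhds_zero_nat M).eventually_lt_const hη] with n hn p x
  exact (abs_wave_le ψ p n x).trans_lt ((by gcongr; exact hM x : |ψ x| / n ≤ M / n).trans_lt hn)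

theorem deriv_wave (hψ : Differentiable ℝ ψ) (p : ℝ) {n : ℕ} (hn : n ≠ 0) (x : ℝ) :
    deriv (wave ψ p n) x = n * waveSlope ψ p n x := by
  have hphase : HasDerivAt (fun x => (n : ℝ) ^ 2 * x + p) ((n : ℝ) ^ 2) x := by
    simpa using ((hasDerivAt_id' x).const_mul ((n : ℝ) ^ 2)).add_const p
  have hwave : HasDerivAt (wave ψ p n) _ x :=
    ((hψ x).hasDerivAt.fun_mul hphase.sin).div_const (n : ℝ)
  have hn' : (n : ℝ) ≠ 0 := mod_cast hn
  rw [hwave.deriv, waveSlope]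
  field_simp

theorem waveSlope_sq_add_sq (ψ : ℝ → ℝ) (n : ℕ) (x : ℝ) :
    waveSlope ψ 0 n x ^ 2 + waveSlope ψ (Real.pi / 2) n x ^ 2 =
      deriv ψ x ^ 2 / n ^ 4 + ψ x ^ 2 := by
  simp only [waveSlope, add_zero, Real.sin_add_pi_div_two, Real.cos_add_pi_div_two]
  linear_combination (deriv ψ x ^ 2 / n ^ 4 + ψ x ^ 2) * Real.sin_sq_add_cos_sq (n ^ 2 * x)

theorem waveSlope_sq_add_sq_le (ψ : ℝ → ℝ) (n : ℕ) (x : ℝ) :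
    waveSlope ψ 0 n x ^ 2 + waveSlope ψ (Real.pi / 2) n x ^ 2 ≤ deriv ψ x ^ 2 + ψ x ^ 2 := by
  rw [waveSlope_sq_add_sq]
  gcongr
  obtain rfl | hn := n.eq_zero_or_pos
  · simpa using sq_nonneg (deriv ψ x)
  · exact div_le_self (sq_nonneg _) (one_le_pow₀ (mod_cast hn))

theorem tendsto_waveSlope_sq_add_sq (ψ : ℝ → ℝ) (x : ℝ) :
    Tendsto (fun n => waveSlope ψ 0 n x ^ 2 + waveSlope ψ (Real.pi / 2) n x ^ 2) atTop
      (𝓝 (ψ x ^ 2)) := by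
  simp only [waveSlope_sq_add_sq]
  have hlim : Tendsto (fun n : ℕ => deriv ψ x ^ 2 / (n : ℝ) ^ 4) atTop (𝓝 0) :=
    tendsto_const_nhds.div_atTop ((tendsto_pow_atTop four_ne_zero).comp tendsto_natCast_atTop_atTop)
  simpa using hlim.add_const (ψ x ^ 2)

theorem tendsto_mul_add_mul_of_nonneg {ι : Type*} {l : Filter ι} {a b f g : ι → ℝ} {A L : ℝ}
    (ha : ∀ i, 0 ≤ a i) (hb : ∀ i, 0 ≤ b i) (hab : Tendsto (fun i => a i + b i) l (𝓝 A))
    (hf : Tendsto f l (𝓝 L)) (hg : Tendsto g l (𝓝 L)) :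
    Tendsto (fun i => a i * f i + b i * g i) l (𝓝 (A * L)) := by
  have herror : Tendsto (fun i => (a i + b i) * (|f i - L| + |g i - L|)) l (𝓝 0) := by
    simpa using hab.mul ((hf.sub_const L).abs.add (hg.sub_const L).abs)
  have hdiff : Tendsto (fun i => a i * (f i - L) + b i * (g i - L)) l (𝓝 0) := by
    refine squeeze_zero_norm (fun i => (norm_add_le _ _).trans ?_) herror
    rw [norm_mul, norm_mul, Real.norm_of_nonneg (ha i), Real.norm_of_nonneg (hb i),
      Real.norm_eq_abs, Real.norm_eq_abs]
    nlinarith [mul_nonneg (ha i) (abs_nonneg (g i - L)), mul_nonneg (hb i) (abs_nonneg (f i - L))]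
  have hsum := hdiff.add (hab.mul_const L)
  rw [zero_add] at hsum
  exact hsum.congr fun i => by ring

variable {E : Type*} [NormedAddCommGroup E] [InnerProductSpace ℝ E] {I : Set ℝ} {τ : ℝ → E}
  {G : ℝ → E} {δ : ℝ}

theorem integrableOn_sq_mul_inner_comp {ρ w : ℝ → ℝ} (hI : MeasurableSet I)
    (hτ : LocallyIntegrableOn τ I) (hG : ContinuousOn G (Ioo (-δ) δ)) (hρ : Continuous ρ)
    (hρc : HasCompactSupport ρ) (hρI : tsupport ρ ⊆ I) (hw : Continuous w)
    (hδ : ∀ x, |w x| < δ) : IntegrableOn (fun x => ρ x ^ 2 * ⟪G (w x), τ x⟫_ℝ) I := by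
  have hcont : Continuous fun x => ρ x ^ 2 • G (w x) :=
    (hρ.pow 2).smul (hG.comp_continuous hw fun x => abs_lt.1 (hδ x))
  have hsupport : tsupport (fun x => ρ x ^ 2 • G (w x)) ⊆ tsupport ρ :=
    closure_mono fun x (hx : _ ≠ 0) (h : ρ x = 0) => hx (by simp [h])
  simpa only [real_inner_smul_left] using integrableOn_inner (𝕜 := ℝ) hI hτ hcont
    (hρc.of_isClosed_subset (isClosed_tsupport _) hsupport) (hsupport.trans hρI)

theorem integrableOn_waveSlope_sq_mul_inner (hI : MeasurableSet I) (hτ : LocallyIntegrableOn τ I)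
    (hG : ContinuousOn G (Ioo (-δ) δ)) (hψ : ContDiff ℝ 1 ψ) (hψc : HasCompactSupport ψ)
    (hψI : tsupport ψ ⊆ I) {p : ℝ} {n : ℕ} (hδ : ∀ x, |wave ψ p n x| < δ) :
    IntegrableOn (fun x => waveSlope ψ p n x ^ 2 * ⟪G (wave ψ p n x), τ x⟫_ℝ) I :=
  integrableOn_sq_mul_inner_comp hI hτ hG (continuous_waveSlope hψ p n)
    (hψc.of_isClosed_subset (isClosed_tsupport _) (tsupport_waveSlope_subset ψ p n))
    ((tsupport_waveSlope_subset ψ p n).trans hψI) (contDiff_wave hψ p n).continuous hδ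

theorem integrableOn_deriv_sq_add_sq_mul {f : ℝ → ℝ} (hI : MeasurableSet I)
    (hf : LocallyIntegrableOn f I) (hψ : ContDiff ℝ 1 ψ) (hψc : HasCompactSupport ψ)
    (hψI : tsupport ψ ⊆ I) : IntegrableOn (fun x => (deriv ψ x ^ 2 + ψ x ^ 2) * f x) I := by
  have hψ' : Continuous (deriv ψ) := hψ.continuous_deriv le_rfl
  have hsupport : tsupport (fun x => deriv ψ x ^ 2 + ψ x ^ 2) ⊆ tsupport ψ :=
    closure_minimal (fun x hx => not_imp_comm.1 (fun h => by
      simp [image_eq_zero_of_notMem_tsupport h,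
        image_eq_zero_of_notMem_tsupport (mt (@tsupport_deriv_subset _ _ _ _ _ ψ x) h)]) hx)
      (isClosed_tsupport ψ)
  exact integrableOn_mul hI hf ((hψ'.pow 2).add (hψ.continuous.pow 2))
    (hψc.of_isClosed_subset (isClosed_tsupport _) hsupport) (hsupport.trans hψI)

theorem tendsto_setIntegral_waveSlope_sq_mul_inner (hI : MeasurableSet I)
    (hτ : LocallyIntegrableOn τ I) (hδ : 0 < δ) (hG : ContinuousOn G (Ioo (-δ) δ))
    (hψ : ContDiff ℝ 1 ψ) (hψc : HasCompactSupport ψ) (hψI : tsupport ψ ⊆ I) :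
    Tendsto (fun n => ∫ x in I, waveSlope ψ 0 n x ^ 2 * ⟪G (wave ψ 0 n x), τ x⟫_ℝ +
      waveSlope ψ (Real.pi / 2) n x ^ 2 * ⟪G (wave ψ (Real.pi / 2) n x), τ x⟫_ℝ) atTop
      (𝓝 (∫ x in I, ψ x ^ 2 * ⟪G 0, τ x⟫_ℝ)) := by
  have hG0 : ContinuousAt G 0 := hG.continuousAt (Ioo_mem_nhds (neg_lt_zero.2 hδ) hδ)
  obtain ⟨η, hη, hbound⟩ := Metric.eventually_nhds_iff.1
    (hG0.norm.eventually_lt_const (lt_add_one ‖G 0‖))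
  have hinner {p : ℝ} {n : ℕ} {x : ℝ} (hn : ∀ p x, |wave ψ p n x| < η) :
      |⟪G (wave ψ p n x), τ x⟫_ℝ| ≤ (‖G 0‖ + 1) * ‖τ x‖ :=
    (abs_real_inner_le_norm _ _).trans <| mul_le_mul_of_nonneg_right
      (hbound (by simpa only [Real.dist_eq, sub_zero] using hn p x)).le (norm_nonneg _)
  refine tendsto_integral_filter_of_dominated_convergence
    (fun x => (‖G 0‖ + 1) * ((deriv ψ x ^ 2 + ψ x ^ 2) * ‖τ x‖)) ?_ ?_ ?_ ?_
  · filter_upwards [eventually_forall_abs_wave_lt hψ.continuous hψc hδ] with n hn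
    exact ((integrableOn_waveSlope_sq_mul_inner hI hτ hG hψ hψc hψI (hn 0)).add
      (integrableOn_waveSlope_sq_mul_inner hI hτ hG hψ hψc hψI (hn _))).aestronglyMeasurable
  · filter_upwards [eventually_forall_abs_wave_lt hψ.continuous hψc hη] with n hn
    refine .of_forall fun x => (abs_add_le _ _).trans ?_
    rw [abs_mul, abs_mul, abs_sq, abs_sq]
    calc _ ≤ waveSlope ψ 0 n x ^ 2 * ((‖G 0‖ + 1) * ‖τ x‖) +
          waveSlope ψ (Real.pi / 2) n x ^ 2 * ((‖G 0‖ + 1) * ‖τ x‖) := by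
            gcongr <;> exact hinner hn
      _ ≤ _ := by
            rw [← add_mul, mul_left_comm]
            exact mul_le_mul_of_nonneg_left (mul_le_mul_of_nonneg_right
              (waveSlope_sq_add_sq_le ψ n x) (norm_nonneg _)) (by positivity)
  · exact (integrableOn_deriv_sq_add_sq_mul hI hτ.norm hψ hψc hψI).const_mul _
  · refine .of_forall fun x => tendsto_mul_add_mul_of_nonneg (fun _ => sq_nonneg _)
      (fun _ => sq_nonneg _) (tendsto_waveSlope_sq_add_sq ψ x) ?_ ?_ <;>
    exact (hG0.tendsto.comp (tendsto_wave ψ _ x)).inner tendsto_const_nhds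

/-- The slopes of two waves in quadrature have squares adding up to `ψ ^ 2` in the limit, and
dividing by `n ^ 2` makes the fixed term `J` disappear. -/
theorem setIntegral_sq_mul_inner_nonneg (hI : MeasurableSet I) (hτ : LocallyIntegrableOn τ I)
    (hδ : 0 < δ) (hG : ContinuousOn G (Ioo (-δ) δ)) (hψ : ContDiff ℝ 1 ψ)
    (hψc : HasCompactSupport ψ) (hψI : tsupport ψ ⊆ I) {J : ℝ}
    (hJ : ∀ w : ℝ → ℝ, ContDiff ℝ 1 w → tsupport w ⊆ tsupport ψ → (∀ x, |w x| < δ) →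
      0 ≤ J + ∫ x in I, deriv w x ^ 2 * ⟪G (w x), τ x⟫_ℝ) :
    0 ≤ ∫ x in I, ψ x ^ 2 * ⟪G 0, τ x⟫_ℝ := by
  have hJn : Tendsto (fun n : ℕ => 2 * J / (n : ℝ) ^ 2) atTop (𝓝 0) :=
    tendsto_const_nhds.div_atTop ((tendsto_pow_atTop two_ne_zero).comp tendsto_natCast_atTop_atTop)
  have hlim := hJn.add (tendsto_setIntegral_waveSlope_sq_mul_inner hI hτ hδ hG hψ hψc hψI)
  rw [zero_add] at hlim
  refine ge_of_tendsto hlim ?_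
  filter_upwards [eventually_forall_abs_wave_lt hψ.continuous hψc hδ, eventually_ne_atTop 0]
    with n hn hn0
  have hnonneg (p : ℝ) : 0 ≤ J / (n : ℝ) ^ 2 +
      ∫ x in I, waveSlope ψ p n x ^ 2 * ⟪G (wave ψ p n x), τ x⟫_ℝ := by
    have hwave := hJ _ (contDiff_wave hψ p n) (tsupport_wave_subset ψ p n) (hn p)
    simp only [deriv_wave (hψ.differentiable one_ne_zero) p hn0, mul_pow, mul_assoc,
      integral_const_mul] at hwave
    have hn2 : (n : ℝ) ^ 2 ≠ 0 := by positivity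
    rw [← mul_div_cancel_left₀ (∫ x in I, _) hn2, ← add_div]
    positivity
  rw [integral_add (integrableOn_waveSlope_sq_mul_inner hI hτ hG hψ hψc hψI (hn 0))
    (integrableOn_waveSlope_sq_mul_inner hI hτ hG hψ hψc hψI (hn _))]
  linarith [hnonneg 0, hnonneg (Real.pi / 2), mul_div_assoc 2 J ((n : ℝ) ^ 2)]

end Oscillation

section Plateau

/-- A compactly supported `C^1` cutoff `c` equal to `1` near `K`, for which `c • y` is an
admissible test function whenever `‖y‖ = s`: multiplying it by `φ ‖c • y‖` keeps it `C^1`, even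
where `c` vanishes and `φ` is singular. -/
structure IsPlateau (φ : ℝ → ℝ) (I K : Set ℝ) (s : ℝ) (c : ℝ → ℝ) : Prop where
  contDiff : ContDiff ℝ 1 c
  contDiff_mul : ContDiff ℝ 1 fun x => c x * φ (c x * s)
  hasCompactSupport : HasCompactSupport c
  tsupport_subset : tsupport c ⊆ I
  nonneg : ∀ x, 0 ≤ c x
  eventuallyEq_one : ∀ x ∈ K, c =ᶠ[𝓝 x] 1

variable {φ : ℝ → ℝ} {I K : Set ℝ}

theorem IsWeight.exists_isPlateau (hφ : IsWeight φ) (hI : IsOpen I) (hK : IsCompact K)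
    (hKI : K ⊆ I) {s : ℝ} (hs : 0 < s) : ∃ c, IsPlateau φ I K s c := by
  obtain ⟨F, hF, hFnonneg, hFeq, hFsqrt⟩ := hφ.exists_contDiff_add_mul_eq_sq
  obtain ⟨ρ, hρ, hcompact, hsupport, -, hone⟩ := exists_contDiff_eventuallyEq_one hI hK hKI
  set h : ℝ := √(s + s * φ s)
  have hFρ : ContDiff ℝ 1 fun x => F (h * ρ x) := hF.comp (contDiff_const.mul hρ)
  have hF0 : F 0 = 0 := by simpa using hFsqrt 0 le_rfl
  have htsupport : tsupport (fun x => F (h * ρ x) / s) ⊆ tsupport ρ :=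
    closure_mono fun x (hx : _ ≠ 0) (h : ρ x = 0) => hx (by simp [h, hF0])
  refine ⟨fun x => F (h * ρ x) / s, hFρ.div_const s, ?_,
    hcompact.of_isClosed_subset (isClosed_tsupport _) htsupport, htsupport.trans hsupport,
    fun x => div_nonneg (hFnonneg _) hs.le, fun x hx => ?_⟩
  · have hmul (x : ℝ) : F (h * ρ x) / s * φ (F (h * ρ x) / s * s) =
        ((h * ρ x) ^ 2 - F (h * ρ x)) / s := by
      rw [div_mul_cancel₀ _ hs.ne', ← hFeq]
      ring
    simp only [hmul]
    exact (((contDiff_const.mul hρ).pow 2).sub hFρ).div_const s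
  · filter_upwards [hone x hx] with t ht
    simp [ht, h, hFsqrt s hs.le, hs.ne']

end Plateau

section Perturbation

variable {E : Type*} [NormedAddCommGroup E] [InnerProductSpace ℝ E] {φ c w : ℝ → ℝ}
  {I K : Set ℝ} {y ζ : E} {x : ℝ}

theorem add_smul_eventuallyEq_of_notMem_tsupport (u : ℝ → E) (ζ : E) (hx : x ∉ tsupport w) :
    (fun t => u t + w t • ζ) =ᶠ[𝓝 x] u := by
  filter_upwards [notMem_tsupport_iff_eventuallyEq.1 hx] with t ht
  rw [ht, Pi.zero_apply, zero_smul, add_zero]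

namespace IsPlateau

variable (hc : IsPlateau φ I K ‖y‖ c)
include hc

theorem perturbation_eventuallyEq_of_mem (ζ : E) (w : ℝ → ℝ) (hx : x ∈ K) :
    (fun t => c t • y + w t • ζ) =ᶠ[𝓝 x] fun t => y + w t • ζ := by
  filter_upwards [hc.eventuallyEq_one x hx] with t ht
  rw [ht, Pi.one_apply, one_smul]

theorem smul_perturbation_eventuallyEq_of_notMem (ζ : E) (hx : x ∉ tsupport w) :
    (fun t => φ ‖c t • y + w t • ζ‖ • (c t • y + w t • ζ)) =ᶠ[𝓝 x]
      fun t => (c t * φ (c t * ‖y‖)) • y := by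
  filter_upwards [add_smul_eventuallyEq_of_notMem_tsupport (fun t => c t • y) ζ hx] with t ht
  rw [ht, norm_smul, Real.norm_of_nonneg (hc.nonneg t), smul_smul, mul_comm]

theorem support_perturbation_subset (ζ : E) (hw : tsupport w ⊆ K) :
    Function.support (fun t => c t • y + w t • ζ) ⊆ Function.support c := by
  intro t (ht : _ ≠ 0) (hct : c t = 0)
  have htw : t ∉ tsupport w := fun htw => by
    simpa [hct] using (hc.eventuallyEq_one t (hw htw)).eq_of_nhds
  exact ht (by simp only [hct, image_eq_zero_of_notMem_tsupport htw, zero_smul, add_zero])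

theorem contDiff_smul_perturbation (hφ : IsWeight φ) (hw : ContDiff ℝ 1 w) (hwK : tsupport w ⊆ K)
    (hne : ∀ t, y + w t • ζ ≠ 0) :
    ContDiff ℝ 1 fun t => φ ‖c t • y + w t • ζ‖ • (c t • y + w t • ζ) := by
  rw [contDiff_iff_contDiffAt]
  intro x
  by_cases hx : x ∈ K
  · refine hφ.contDiffAt_smul
      ((hc.contDiff.smul contDiff_const).add (hw.smul contDiff_const)).contDiffAt ?_
    rw [(hc.perturbation_eventuallyEq_of_mem ζ w hx).eq_of_nhds]
    exact hne x
  · exact (hc.contDiff_mul.smul contDiff_const).contDiffAt.congr_of_eventuallyEq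
      (hc.smul_perturbation_eventuallyEq_of_notMem ζ (mt (@hwK x) hx))

end IsPlateau

end Perturbation

section Necessity

variable {m : ℕ} {φ c w : ℝ → ℝ} {I K : Set ℝ} {𝓑 : ℝ → Matrix (Fin m) (Fin m) ℂ}
  {y ζ : EuclideanSpace ℂ (Fin m)}

namespace IsPlateau

variable (hc : IsPlateau φ I K ‖y‖ c)
include hc

theorem isTest_perturbation (hw : ContDiff ℝ 1 w) (hwK : tsupport w ⊆ K) :
    IsTest I fun t => c t • y + w t • ζ := by
  have hsupport := closure_mono (hc.support_perturbation_subset ζ hwK)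
  exact ⟨(hc.contDiff.smul contDiff_const).add (hw.smul contDiff_const),
    hc.hasCompactSupport.of_isClosed_subset (isClosed_tsupport _) hsupport,
    hsupport.trans hc.tsupport_subset⟩

theorem isTest_smul_perturbation (hφ : IsWeight φ) (hw : ContDiff ℝ 1 w) (hwK : tsupport w ⊆ K)
    (hne : ∀ t, y + w t • ζ ≠ 0) :
    IsTest I fun t => φ ‖c t • y + w t • ζ‖ • (c t • y + w t • ζ) := by
  have hsupport := closure_mono ((Function.support_smul_subset_right
    (fun t => φ ‖c t • y + w t • ζ‖) _).trans (hc.support_perturbation_subset ζ hwK))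
  exact ⟨hc.contDiff_smul_perturbation hφ hw hwK hne,
    hc.hasCompactSupport.of_isClosed_subset (isClosed_tsupport _) hsupport,
    hsupport.trans hc.tsupport_subset⟩

/-- At every point either the cutoff or the perturbation is locally constant, so no mixed terms
appear. -/
theorem energyDensity_perturbation (hφ : IsWeight φ) (hw : ContDiff ℝ 1 w) (hwK : tsupport w ⊆ K)
    (hne : ∀ t, y + w t • ζ ≠ 0) (x : ℝ) :
    energyDensity φ 𝓑 (fun t => c t • y + w t • ζ) x =
      deriv c x * deriv (fun t => c t * φ (c t * ‖y‖)) x * ⟪y, realLin (𝓑 x) y⟫_ℝ +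
      deriv w x ^ 2 * ⟪weightDeriv φ (y + w x • ζ) ζ, realLin (𝓑 x) ζ⟫_ℝ := by
  by_cases hx : x ∈ tsupport w
  · have hu : HasDerivAt (fun t => y + w t • ζ) (deriv w x • ζ) x :=
      ((hw.differentiable one_ne_zero x).hasDerivAt.smul_const ζ).const_add y
    have hueq := hc.perturbation_eventuallyEq_of_mem ζ w (hwK hx)
    have hv : deriv (fun t => φ ‖c t • y + w t • ζ‖ • (c t • y + w t • ζ)) x =
        deriv w x • weightDeriv φ (y + w x • ζ) ζ := by
      rw [← weightDeriv_smul]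
      exact (hueq.fun_comp fun z => φ ‖z‖ • z).deriv_eq.trans (hφ.hasDerivAt_smul hu (hne x)).deriv
    have hc' : deriv c x = 0 := by
      rw [(hc.eventuallyEq_one x (hwK hx)).deriv_eq]
      exact deriv_const x 1
    rw [energyDensity, hueq.deriv_eq, hu.deriv, hv, map_smul, real_inner_smul_left,
      real_inner_smul_right, hc']
    ring
  · have hw' : deriv w x = 0 :=
      image_eq_zero_of_notMem_tsupport (mt (@tsupport_deriv_subset _ _ _ _ _ w x) hx)
    have hk := (hc.contDiff_mul.differentiable one_ne_zero x).hasDerivAt.smul_const y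
    have hc' := (hc.contDiff.differentiable one_ne_zero x).hasDerivAt.smul_const y
    rw [energyDensity,
      (add_smul_eventuallyEq_of_notMem_tsupport (fun t => c t • y) ζ hx).deriv_eq, hc'.deriv,
      (hc.smul_perturbation_eventuallyEq_of_notMem ζ hx).deriv_eq, hk.deriv, map_smul,
      real_inner_smul_left, real_inner_smul_right, hw']
    ring

end IsPlateau

theorem IsWeight.continuousOn_weightDeriv_add_smul {E : Type*} [NormedAddCommGroup E]
    [InnerProductSpace ℝ E] (hφ : IsWeight φ) {y ζ : E} {s : Set ℝ}
    (hs : ∀ t ∈ s, y + t • ζ ≠ 0) : ContinuousOn (fun t => weightDeriv φ (y + t • ζ) ζ) s :=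
  hφ.continuousOn_weightDeriv.comp (f := fun t : ℝ => (y + t • ζ, ζ))
    (by fun_prop) hs

theorem locallyIntegrableOn_inner_realLin (hI : IsOpen I)
    (h𝓑 : ∀ i j, LocallyIntegrableOn (fun x => 𝓑 x i j) I) (y ζ : EuclideanSpace ℂ (Fin m)) :
    LocallyIntegrableOn (fun x => ⟪y, realLin (𝓑 x) ζ⟫_ℝ) I :=
  (innerSL ℝ y).locallyIntegrableOn_comp (locallyIntegrableOn_realLin hI h𝓑 continuous_const)

theorem setIntegral_perturbation_nonneg (hφ : IsWeight φ) (hI : IsOpen I) (hKI : K ⊆ I)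
    (h𝓑 : ∀ i j, LocallyIntegrableOn (fun x => 𝓑 x i j) I) (hdiss : LPhiDissipative φ I 𝓑)
    (hc : IsPlateau φ I K ‖y‖ c) {δ : ℝ} (hne : ∀ t : ℝ, |t| < δ → y + t • ζ ≠ 0)
    (hw : ContDiff ℝ 1 w) (hwc : HasCompactSupport w) (hwK : tsupport w ⊆ K)
    (hwδ : ∀ x, |w x| < δ) :
    0 ≤ (∫ x in I, deriv c x * deriv (fun t => c t * φ (c t * ‖y‖)) x *
        ⟪y, realLin (𝓑 x) y⟫_ℝ) +
      ∫ x in I, deriv w x ^ 2 * ⟪weightDeriv φ (y + w x • ζ) ζ, realLin (𝓑 x) ζ⟫_ℝ := by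
  have hnew (t : ℝ) := hne _ (hwδ t)
  have henergy := (lPhiDissipative_iff_setIntegral_energyDensity_nonneg hI h𝓑).1 hdiss _
    (hc.isTest_perturbation hw hwK) (hc.isTest_smul_perturbation hφ hw hwK hnew)
  simp only [hc.energyDensity_perturbation hφ hw hwK hnew] at henergy
  have hG : ContinuousOn (fun t => weightDeriv φ (y + t • ζ) ζ) (Ioo (-δ) δ) :=
    hφ.continuousOn_weightDeriv_add_smul fun t ht => hne t (abs_lt.2 ht)
  have hτ := locallyIntegrableOn_realLin hI h𝓑 (continuous_const (y := ζ))
  have hperturbation := integrableOn_sq_mul_inner_comp hI.measurableSet hτ hG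
    (hw.continuous_deriv le_rfl) hwc.deriv (tsupport_deriv_subset.trans (hwK.trans hKI))
    hw.continuous hwδ
  have hsupport : tsupport (deriv c * deriv fun t => c t * φ (c t * ‖y‖)) ⊆ tsupport c :=
    (tsupport_mul_subset_left ..).trans tsupport_deriv_subset
  have hplateau := integrableOn_mul hI.measurableSet (locallyIntegrableOn_inner_realLin hI h𝓑 y y)
    ((hc.contDiff.continuous_deriv le_rfl).mul (hc.contDiff_mul.continuous_deriv le_rfl))
    (hc.hasCompactSupport.of_isClosed_subset (isClosed_tsupport _) hsupport)
    (hsupport.trans hc.tsupport_subset)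
  simp only [Pi.mul_apply] at hplateau
  rwa [← integral_add hplateau hperturbation]

theorem setIntegral_sq_mul_weightDeriv_nonneg (hφ : IsWeight φ) (hI : IsOpen I)
    (h𝓑 : ∀ i j, LocallyIntegrableOn (fun x => 𝓑 x i j) I) (hdiss : LPhiDissipative φ I 𝓑)
    (hy : y ≠ 0) (ζ : EuclideanSpace ℂ (Fin m)) {ψ : ℝ → ℝ} (hψ : ContDiff ℝ 1 ψ)
    (hψc : HasCompactSupport ψ) (hψI : tsupport ψ ⊆ I) :
    0 ≤ ∫ x in I, ψ x ^ 2 * ⟪weightDeriv φ y ζ, realLin (𝓑 x) ζ⟫_ℝ := by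
  obtain ⟨c, hc⟩ := hφ.exists_isPlateau hI hψc hψI (norm_pos_iff.2 hy)
  have hline : ContinuousAt (fun t : ℝ => y + t • ζ) 0 := by fun_prop
  obtain ⟨δ, hδ, hne⟩ := Metric.eventually_nhds_iff.1
    (hline.eventually_ne (by simpa using hy : y + (0 : ℝ) • ζ ≠ 0))
  simp only [Real.dist_eq, sub_zero] at hne
  simpa only [zero_smul, add_zero] using setIntegral_sq_mul_inner_nonneg hI.measurableSet
    (locallyIntegrableOn_realLin hI h𝓑 continuous_const) hδ
    (hφ.continuousOn_weightDeriv_add_smul fun t ht => hne (abs_lt.2 ht)) hψ hψc hψI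
    fun w hw hwψ hwδ => setIntegral_perturbation_nonneg hφ hI hψI h𝓑 hdiss hc (fun t => @hne t)
      hw (hψc.of_isClosed_subset (isClosed_tsupport w) hwψ) hwψ hwδ

theorem ae_forall_nonneg_of_forall_ae {α X : Type*} [MeasurableSpace α] {μ : Measure α}
    [TopologicalSpace X] [TopologicalSpace.SeparableSpace X] {f : α → X → ℝ}
    (hf : ∀ a, Continuous (f a)) (h : ∀ x, ∀ᵐ a ∂μ, 0 ≤ f a x) : ∀ᵐ a ∂μ, ∀ x, 0 ≤ f a x := by
  obtain ⟨D, hD, hdense⟩ := TopologicalSpace.exists_countable_dense X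
  filter_upwards [(ae_ball_iff hD).2 fun x _ => h x] with a ha x
  exact closure_minimal ha (isClosed_le continuous_const (hf a)) (hdense x)

theorem ae_pointwiseDissipative_of_lPhiDissipative (hφ : IsWeight φ) (hI : IsOpen I)
    (h𝓑 : ∀ i j, LocallyIntegrableOn (fun x => 𝓑 x i j) I) (hdiss : LPhiDissipative φ I 𝓑) :
    ∀ᵐ x ∂volume.restrict I, PointwiseDissipative φ (realLin (𝓑 x)) := by
  have hcont (x : ℝ) : Continuous fun p : {y : EuclideanSpace ℂ (Fin m) // y ≠ 0} ×
      EuclideanSpace ℂ (Fin m) => ⟪weightDeriv φ p.1.1 p.2, realLin (𝓑 x) p.2⟫_ℝ :=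
    (hφ.continuousOn_weightDeriv.comp_continuous
      (f := fun p : {y : EuclideanSpace ℂ (Fin m) // y ≠ 0} × _ => (p.1.1, p.2))
      (by fun_prop) fun p => p.1.2).inner
      ((realLin (𝓑 x)).continuous_of_finiteDimensional.comp continuous_snd)
  have hall := ae_forall_nonneg_of_forall_ae hcont fun p =>
    ae_nonneg_of_forall_setIntegral_sq_mul hI (locallyIntegrableOn_inner_realLin hI h𝓑 _ _)
      fun ψ hψ hψc hψI =>
        setIntegral_sq_mul_weightDeriv_nonneg hφ hI h𝓑 hdiss p.1.2 p.2 hψ hψc hψI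
  filter_upwards [hall] with x hx y ζ hy
  exact hx (⟨y, hy⟩, ζ)

theorem lPhiDissipative_iff_ae_pointwiseDissipative (hφ : IsWeight φ) (hI : IsOpen I)
    (h𝓑 : ∀ i j, LocallyIntegrableOn (fun x => 𝓑 x i j) I) :
    LPhiDissipative φ I 𝓑 ↔ ∀ᵐ x ∂volume.restrict I, PointwiseDissipative φ (realLin (𝓑 x)) :=
  ⟨ae_pointwiseDissipative_of_lPhiDissipative hφ hI h𝓑,
    lPhiDissipative_of_ae_pointwiseDissipative hφ hI h𝓑⟩

end Necessity

section EssInf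

variable {φ : ℝ → ℝ} {I : Set ℝ} {m : ℕ} {𝓐 : ℝ → Matrix (Fin m) (Fin m) ℝ}

theorem isOpen_interval (a b : EReal) : IsOpen (interval a b) :=
  (isOpen_lt continuous_const continuous_coe_real_ereal).inter
    (isOpen_lt continuous_coe_real_ereal continuous_const)

theorem locallyIntegrableOn_shifted
    (hint : ∀ i j, LocallyIntegrableOn (fun x => 𝓐 x i j) I) (κ : ℝ) (i j : Fin m) :
    LocallyIntegrableOn (fun x => shifted 𝓐 κ x i j) I :=
  Complex.ofRealCLM.locallyIntegrableOn_comp ((hint i j).sub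
    (locallyIntegrableOn_const ((κ • (1 : Matrix (Fin m) (Fin m) ℝ)) i j)))

theorem lPhiDissipative_shifted_iff (hφ : IsWeight φ) (hI : IsOpen I) (hm : 1 ≤ m)
    (hint : ∀ i j, LocallyIntegrableOn (fun x => 𝓐 x i j) I)
    (hsymm : ∀ᵐ x ∂volume.restrict I, (𝓐 x).IsSymm) (κ : ℝ) :
    LPhiDissipative φ I (shifted 𝓐 κ) ↔ ∀ᵐ x ∂volume.restrict I, κ ≤ eigMin (𝓐 x) ∧
      (1 - lamInftySq φ) * (κ * (eigMin (𝓐 x) + eigMax (𝓐 x) - κ)) ≤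
        eigMin (𝓐 x) * eigMax (𝓐 x) - lamInftySq φ / 4 * (eigMin (𝓐 x) + eigMax (𝓐 x)) ^ 2 := by
  rw [lPhiDissipative_iff_ae_pointwiseDissipative hφ hI (locallyIntegrableOn_shifted hint κ)]
  refine Filter.eventually_congr ?_
  filter_upwards [hsymm] with x hx
  exact pointwiseDissipative_shifted_iff hφ hm (Matrix.isHermitian_iff_isSymm.2 hx) κ

theorem eigenCondition_of_lPhiDissipative (hφ : IsWeight φ) (hΛ : lamInftySq φ < 1)
    (hI : IsOpen I) (hm : 1 ≤ m) (hint : ∀ i j, LocallyIntegrableOn (fun x => 𝓐 x i j) I)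
    (hsymm : ∀ᵐ x ∂volume.restrict I, (𝓐 x).IsSymm) {κ : ℝ} (hκ : 0 < κ)
    (hdiss : LPhiDissipative φ I (shifted 𝓐 κ)) : EigenCondition φ I 𝓐 := by
  have hΛ' : 0 < 1 - lamInftySq φ := sub_pos.2 hΛ
  have hbound : 0 < (1 - lamInftySq φ) * (κ * κ) := mul_pos hΛ' (mul_pos hκ hκ)
  refine (EReal.coe_pos.2 hbound).trans_le (le_essInf_of_ae_le _ ?_)
  filter_upwards [hsymm, (lPhiDissipative_shifted_iff hφ hI hm hint hsymm κ).1 hdiss]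
    with x hx ⟨hκmin, hineq⟩
  have hx := Matrix.isHermitian_iff_isSymm.2 hx
  have hminmax : eigMin (𝓐 x) ≤ eigMax (𝓐 x) := le_eigMax (eigMin_mem hm hx)
  refine EReal.coe_le_coe_iff.2 (le_trans ?_ hineq)
  gcongr
  linarith

/-- With `c > 0` below the essential infimum and `D` above all eigenvalues, `κ = c / (2 D)` works,
because `κ (μ₁ + μ_m - κ) ≤ 2 κ D = c`. -/
theorem exists_lPhiDissipative_of_eigenCondition (hφ : IsWeight φ) (hI : IsOpen I) (hm : 1 ≤ m)
    (hint : ∀ i j, LocallyIntegrableOn (fun x => 𝓐 x i j) I)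
    (hsymm : ∀ᵐ x ∂volume.restrict I, (𝓐 x).IsSymm)
    (hpos : ∀ᵐ x ∂volume.restrict I, ∀ ξ : Fin m → ℝ, ξ ≠ 0 → 0 < (𝓐 x).mulVec ξ ⬝ᵥ ξ)
    {C : ℝ} (hC : ∀ᵐ x ∂volume.restrict I,
      ∀ ξ : Fin m → ℝ, (𝓐 x).mulVec ξ ⬝ᵥ ξ ≤ C * (ξ ⬝ᵥ ξ))
    (hcond : EigenCondition φ I 𝓐) : ∃ κ : ℝ, 0 < κ ∧ LPhiDissipative φ I (shifted 𝓐 κ) := by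
  obtain ⟨c, hc₀, hc⟩ := EReal.lt_iff_exists_real_btwn.1 hcond
  have hc_pos : 0 < c := EReal.coe_pos.1 hc₀
  set D := max C 1
  have hD : 0 < D := lt_max_of_lt_right one_pos
  have hκ : 0 < c / (2 * D) := by positivity
  refine ⟨c / (2 * D), hκ, (lPhiDissipative_shifted_iff hφ hI hm hint hsymm _).2 ?_⟩
  filter_upwards [hsymm, hpos, hC, ae_lt_of_lt_essInf hc] with x hx hposx hCx hcx
  have hx := Matrix.isHermitian_iff_isSymm.2 hx
  have hcx := (EReal.coe_lt_coe_iff.1 hcx).le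
  have hmin : 0 < eigMin (𝓐 x) := eigMin_pos hm hx hposx
  have hmax : eigMax (𝓐 x) ≤ D := (eigMax_le_of_forall hm hx hCx).trans (le_max_left ..)
  have hminmax : eigMin (𝓐 x) ≤ eigMax (𝓐 x) := le_eigMax (eigMin_mem hm hx)
  have hΛ₀ : 0 ≤ lamInftySq φ / 4 * (eigMin (𝓐 x) + eigMax (𝓐 x)) ^ 2 :=
    mul_nonneg (div_nonneg (lamInftySq_nonneg φ) zero_le_four) (sq_nonneg _)
  have hκmin : c / (2 * D) ≤ eigMin (𝓐 x) := by
    rw [div_le_iff₀ (by positivity)]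
    nlinarith
  refine ⟨hκmin, le_trans ?_ hcx⟩
  have hΛ_le : 1 - lamInftySq φ ≤ 1 := sub_le_self _ (lamInftySq_nonneg φ)
  calc (1 - lamInftySq φ) * (c / (2 * D) * (eigMin (𝓐 x) + eigMax (𝓐 x) - c / (2 * D)))
      ≤ c / (2 * D) * (eigMin (𝓐 x) + eigMax (𝓐 x) - c / (2 * D)) :=
        mul_le_of_le_one_left (mul_nonneg hκ.le (by linarith)) hΛ_le
    _ ≤ c / (2 * D) * (2 * D) := by
        gcongr
        linarith
    _ = c := div_mul_cancel₀ _ (by positivity)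

theorem eigenCondition_fin_two {𝓐 : ℝ → Matrix (Fin 2) (Fin 2) ℝ}
    (hsymm : ∀ᵐ x ∂volume.restrict I, (𝓐 x).IsSymm) :
    EigenCondition φ I 𝓐 ↔
      0 < essInfOn I (fun x => (𝓐 x).det - lamInftySq φ / 4 * (𝓐 x).trace ^ 2) := by
  rw [EigenCondition, essInfOn, essInfOn, essInf_congr_ae]
  filter_upwards [hsymm] with x hx
  have hx := Matrix.isHermitian_iff_isSymm.2 hx
  rw [eigMin_mul_eigMax_eq_det hx, eigMin_add_eigMax_eq_trace hx]

end EssInf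

end FunctionalDissipativity

open FunctionalDissipativity in
theorem mainTheorem10_general (φ : ℝ → ℝ) (hφ : IsWeight φ) (hΛ : lamInftySq φ < 1)
    {I : Set ℝ} (hI : IsOpen I) {m : ℕ} (hm : 1 ≤ m) {𝓐 : ℝ → Matrix (Fin m) (Fin m) ℝ}
    (hint : ∀ i j, LocallyIntegrableOn (fun x => 𝓐 x i j) I)
    (hsymm : ∀ᵐ x ∂volume.restrict I, (𝓐 x).IsSymm)
    (hpos : ∀ᵐ x ∂volume.restrict I, ∀ ξ : Fin m → ℝ, ξ ≠ 0 → 0 < (𝓐 x).mulVec ξ ⬝ᵥ ξ) :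
    ((∃ κ : ℝ, 0 < κ ∧ LPhiDissipative φ I (shifted 𝓐 κ)) → EigenCondition φ I 𝓐) ∧
    ((∃ C : ℝ, ∀ᵐ x ∂volume.restrict I, ∀ ξ : Fin m → ℝ, (𝓐 x).mulVec ξ ⬝ᵥ ξ ≤ C * (ξ ⬝ᵥ ξ)) →
      EigenCondition φ I 𝓐 → ∃ κ : ℝ, 0 < κ ∧ LPhiDissipative φ I (shifted 𝓐 κ)) ∧
    (m = 2 → (EigenCondition φ I 𝓐 ↔
      0 < essInfOn I (fun x => (𝓐 x).det - lamInftySq φ / 4 * (𝓐 x).trace ^ 2))) := by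
  refine ⟨?_, ?_, ?_⟩
  · rintro ⟨κ, hκ, hdiss⟩
    exact eigenCondition_of_lPhiDissipative hφ hΛ hI hm hint hsymm hκ hdiss
  · rintro ⟨C, hC⟩ hcond
    exact exists_lPhiDissipative_of_eigenCondition hφ hI hm hint hsymm hpos hC hcond
  · rintro rfl
    exact eigenCondition_fin_two hsymm

theorem mainTheorem10 (φ : ℝ → ℝ) (hφ : FunctionalDissipativity.Admissible φ)
    (hΛ : FunctionalDissipativity.lamInftySq φ < 1)
    (a b : EReal) (hab : a < b) (m : ℕ) (hm : 1 ≤ m)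
    (𝓐 : ℝ → Matrix (Fin m) (Fin m) ℝ)
    (hint : ∀ i j, LocallyIntegrableOn (fun x => 𝓐 x i j)
      (FunctionalDissipativity.interval a b) volume)
    (hsymm : ∀ᵐ x ∂(volume.restrict (FunctionalDissipativity.interval a b)), (𝓐 x).IsSymm)
    (hpos : ∀ᵐ x ∂(volume.restrict (FunctionalDissipativity.interval a b)),
      ∀ ξ : Fin m → ℝ, ξ ≠ 0 → 0 < (𝓐 x).mulVec ξ ⬝ᵥ ξ) :
    ((∃ κ : ℝ, 0 < κ ∧ FunctionalDissipativity.LPhiDissipative φ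
        (FunctionalDissipativity.interval a b) (FunctionalDissipativity.shifted 𝓐 κ)) →
      FunctionalDissipativity.EigenCondition φ (FunctionalDissipativity.interval a b) 𝓐) ∧
    ((∃ C : ℝ, ∀ᵐ x ∂(volume.restrict (FunctionalDissipativity.interval a b)),
        ∀ ξ : Fin m → ℝ, (𝓐 x).mulVec ξ ⬝ᵥ ξ ≤ C * (ξ ⬝ᵥ ξ)) →
      FunctionalDissipativity.EigenCondition φ (FunctionalDissipativity.interval a b) 𝓐 →
      ∃ κ : ℝ, 0 < κ ∧ FunctionalDissipativity.LPhiDissipative φ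
        (FunctionalDissipativity.interval a b) (FunctionalDissipativity.shifted 𝓐 κ)) ∧
    (m = 2 →
      (FunctionalDissipativity.EigenCondition φ (FunctionalDissipativity.interval a b) 𝓐 ↔
        0 < FunctionalDissipativity.essInfOn (FunctionalDissipativity.interval a b)
          (fun x => (𝓐 x).det
            - FunctionalDissipativity.lamInftySq φ / 4 * (𝓐 x).trace ^ 2))) :=
  mainTheorem10_general φ hφ.isWeight hΛ (FunctionalDissipativity.isOpen_interval a b) hm hint hsymm
    hpos
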